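/- Work in a model $\mathcal E$ of extensional type theory, i.e. a locally cartesian closed category with finite limits and finite coproducts. A \emph{universe} is a morphism $p : El \to Ty$; it is \emph{generic} for the class of its pullbacks, called the $U$-small families; a \emph{map of universes} is a cartesian square between them. \emph{Codes} on a universe are operations on $Ty$, stable under substitution, for dependent products, dependent sums, equality types, the unit type and the booleans; the universe with these codes is a \emph{weak Tarski universe} if the codes decode to the respective types up to isomorphism. Let $U_0 : U_1 : \dots : U_\omega$ be a weakly cumulative hierarchy of weak Tarski universes: for all $i<j\le\omega$ the object $Ty_i$ is $U_j$-small, and there is a map of universes $U_i \to U_j$ (the lifts need not commute with codes or with each other). Suppose that $U_\omega$ supports large induction-recursion: for every type $D$, every inductive-recursive definition of a type $X$ and a function $X \to D$ by finitely many constructors, with argument types coded in $U_\omega$, has a solution (an initial interpretation of its introduction rules and defining equations) with $X$ being $U_\omega$-small. Then there are universes $V_0 : V_1 : \dots$ with decoding maps of universes $\mathrm{dec}_i : V_i \to U_\omega$ such that 1. each $V_i$ has codes for dependent products, dependent sums, equality types, unit and booleans; those for products, sums and equality types are injective operations, and $\mathrm{dec}_i$ sends each code to the corresponding code of $U_\omega$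 on the nose; 2. there are a code $v_k$ of the type $V_k$ in $U_\omega$ and, for all $k<i$, a code $\mathrm{uni}_k$ in $V_i$ with $\mathrm{dec}_i(\mathrm{uni}_k) = v_k$; 3. the hierarchy is strictly cumulative: there are maps of universes $V_i \to V_j$ for $i\le j$, strictly functorial, commuting strictly with decoding and with all the codes, including the $\mathrm{uni}_k$; 4. there are maps of universes $\mathrm{up}_i : U_i \to V_i$ whose composite with $\mathrm{dec}_i$ is the given lift $U_i \to U_\omega$; in particular every $U_i$-small family is $V_i$-small; 5. $V_i$ is generic for the same class of families as $U_i$ whenever the types $V_k$, $k<i$, are $U_i$-small. If every $U_{i+1}$ supports small induction-recursion (inductive-recursive definitions of $X$ in $U_{i+1}$ and $X\to Ty_i$), then $V_i$ is generic for the same class of families as $U_i$ for every $i$. -/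

import Mathlib

open CategoryTheory CategoryTheory.Limits

universe v u

namespace TarskiUniverse

/-- A category with pullbacks is locally cartesian closed when every pullback functor
`Over Y ⥤ Over X` has a right adjoint (the dependent product). Locally cartesian closed categories
with finite limits and finite coproducts are the models of extensional type theory used here:
objects are contexts, a type over `Γ` is a morphism into `Γ`, and a term of `X ⟶ Γ` is a section
of it. -/
class LCCC (E : Type u) [Category.{v} E] [HasPullbacks E] : Prop where
  isLeftAdjoint : ∀ {X Y : E} (f : X ⟶ Y), (Over.pullback f).IsLeftAdjoint

attribute [instance] LCCC.isLeftAdjoint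

/-- The data of a universe à la Tarski: an object `Ty` of codes and the family `p : El ⟶ Ty` of
the types that are decoded from them. -/
structure Univ (E : Type u) [Category.{v} E] where
  Ty : E
  El : E
  p : El ⟶ Ty

section Basic

variable {E : Type u} [Category.{v} E]

namespace Univ

variable (U : Univ E)

/-- The code `a`, in context `Γ`, decodes (up to isomorphism over `Γ`) to the family `f`. -/
def Decodes {X Γ : E} (a : Γ ⟶ U.Ty) (f : X ⟶ Γ) : Prop :=
  ∃ t : X ⟶ U.El, IsPullback t f U.p a

/-- The class of families for which `U.p` is generic: the pullbacks of `U.p`. -/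
def Small {X Γ : E} (f : X ⟶ Γ) : Prop :=
  ∃ a : Γ ⟶ U.Ty, U.Decodes a f

/-- Two universes are generic for the same class of families. -/
def SameClass (V : Univ E) : Prop :=
  ∀ ⦃X Γ : E⦄ (f : X ⟶ Γ), U.Small f ↔ V.Small f

/-- A map of universes: a map of codes together with an identification, up to isomorphism, of the
decoded families. This is what a lift from a universe to a larger one has to provide. -/
@[ext]
structure Hom (U W : Univ E) where
  ty : U.Ty ⟶ W.Ty
  el : U.El ⟶ W.El
  isPullback : IsPullback el U.p W.p ty

/-- The identity lift. -/
def Hom.id : Hom U U where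
  ty := 𝟙 _
  el := 𝟙 _
  isPullback := IsPullback.of_id_fst

variable {U}

/-- Composition of lifts. -/
def Hom.comp {V W : Univ E} (h : Hom U V) (k : Hom V W) : Hom U W where
  ty := h.ty ≫ k.ty
  el := h.el ≫ k.el
  isPullback := h.isPullback.paste_horiz k.isPullback

end Univ

end Basic

section Codes

variable {E : Type u} [Category.{v} E] [HasFiniteLimits E]

namespace Univ

variable (U : Univ E)

/-- The context `Γ, x : El a`. -/
noncomputable abbrev ext {Γ : E} (a : Γ ⟶ U.Ty) : E := pullback a U.p

/-- The context projection `Γ, x : El a ⟶ Γ`. -/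
noncomputable abbrev proj {Γ : E} (a : Γ ⟶ U.Ty) : U.ext a ⟶ Γ := pullback.fst a U.p

/-- The substitution `(Δ, x : El b) ⟶ (Γ, x : El a)` induced by `τ : Δ ⟶ Γ` if `b = a[τ]`. -/
noncomputable def extMap {Γ Δ : E} (τ : Δ ⟶ Γ) {a : Γ ⟶ U.Ty} {b : Δ ⟶ U.Ty} (h : b = τ ≫ a) :
    U.ext b ⟶ U.ext a :=
  pullback.lift (pullback.fst b U.p ≫ τ) (pullback.snd b U.p)
    (by rw [Category.assoc, ← h, pullback.condition])

/-- A code `A` in context `Γ` with a family of codes `B` in context `Γ, x : El A`. -/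
@[ext]
structure Fam (Γ : E) where
  dom : Γ ⟶ U.Ty
  cod : U.ext dom ⟶ U.Ty

/-- Two elements, in context `Γ`, of the same code. -/
@[ext]
structure Pair (Γ : E) where
  lhs : Γ ⟶ U.El
  rhs : Γ ⟶ U.El
  eq : lhs ≫ U.p = rhs ≫ U.p

variable {U}

/-- Substitution in a family of codes. -/
noncomputable def Fam.subst {Γ Δ : E} (τ : Δ ⟶ Γ) (x : U.Fam Γ) : U.Fam Δ where
  dom := τ ≫ x.dom
  cod := U.extMap τ rfl ≫ x.cod

/-- Substitution in a pair of elements. -/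
def Pair.subst {Γ Δ : E} (τ : Δ ⟶ Γ) (x : U.Pair Γ) : U.Pair Δ where
  lhs := τ ≫ x.lhs
  rhs := τ ≫ x.rhs
  eq := by rw [Category.assoc, Category.assoc, x.eq]

/-- For a map of universes `h`, the comparison `(Γ, x : El (h a)) ⟶ (Γ, x : El a)`. -/
noncomputable def Hom.extBack {W : Univ E} (h : Hom U W) {Γ : E} (a : Γ ⟶ U.Ty) :
    W.ext (a ≫ h.ty) ⟶ U.ext a :=
  pullback.lift (pullback.fst (a ≫ h.ty) W.p)
    (h.isPullback.lift (pullback.snd (a ≫ h.ty) W.p) (pullback.fst (a ≫ h.ty) W.p ≫ a)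
      (by rw [Category.assoc, pullback.condition]))
    (by rw [IsPullback.lift_snd])

/-- The action of a map of universes on families of codes. -/
noncomputable def Hom.fam {W : Univ E} (h : Hom U W) {Γ : E} (x : U.Fam Γ) : W.Fam Γ where
  dom := x.dom ≫ h.ty
  cod := h.extBack x.dom ≫ x.cod ≫ h.ty

/-- The action of a map of universes on pairs of elements. -/
def Hom.pair {W : Univ E} (h : Hom U W) {Γ : E} (x : U.Pair Γ) : W.Pair Γ where
  lhs := x.lhs ≫ h.el
  rhs := x.rhs ≫ h.el
  eq := by
    rw [Category.assoc, Category.assoc, h.isPullback.w, ← Category.assoc, x.eq, Category.assoc]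

variable (U)

/-- A choice, stable under substitution, of operations on codes: dependent products, dependent
sums, equality types, the unit type and the booleans. -/
structure Codes where
  pi : ∀ {Γ : E}, U.Fam Γ → (Γ ⟶ U.Ty)
  sigma : ∀ {Γ : E}, U.Fam Γ → (Γ ⟶ U.Ty)
  eq : ∀ {Γ : E}, U.Pair Γ → (Γ ⟶ U.Ty)
  unit : ⊤_ E ⟶ U.Ty
  bool : ⊤_ E ⟶ U.Ty
  pi_subst : ∀ {Γ Δ : E} (τ : Δ ⟶ Γ) (x : U.Fam Γ), τ ≫ pi x = pi (x.subst τ)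
  sigma_subst : ∀ {Γ Δ : E} (τ : Δ ⟶ Γ) (x : U.Fam Γ), τ ≫ sigma x = sigma (x.subst τ)
  eq_subst : ∀ {Γ Δ : E} (τ : Δ ⟶ Γ) (x : U.Pair Γ), τ ≫ eq x = eq (x.subst τ)

variable {U}

/-- The operations on codes decode, up to isomorphism, to the type formers that they are named
after. A universe with such codes is a weak universe à la Tarski. -/
structure Codes.IsWeak [HasFiniteCoproducts E] [LCCC E] (c : U.Codes) : Prop where
  pi : ∀ {Γ : E} (x : U.Fam Γ),
    U.Decodes (c.pi x)
      ((Over.pullback (U.proj x.dom)).rightAdjoint.obj (Over.mk (U.proj x.cod))).hom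
  sigma : ∀ {Γ : E} (x : U.Fam Γ), U.Decodes (c.sigma x) (U.proj x.cod ≫ U.proj x.dom)
  eq : ∀ {Γ : E} (x : U.Pair Γ), U.Decodes (c.eq x) (equalizer.ι x.lhs x.rhs)
  unit : U.Decodes c.unit (𝟙 (⊤_ E))
  bool : U.Decodes c.bool (terminal.from ((⊤_ E) ⨿ (⊤_ E)))

/-- The operations on codes are injective (on generalized elements, hence internally). -/
structure Codes.IsInjective (c : U.Codes) : Prop where
  pi : ∀ Γ : E, Function.Injective (c.pi : U.Fam Γ → (Γ ⟶ U.Ty))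
  sigma : ∀ Γ : E, Function.Injective (c.sigma : U.Fam Γ → (Γ ⟶ U.Ty))
  eq : ∀ Γ : E, Function.Injective (c.eq : U.Pair Γ → (Γ ⟶ U.Ty))

/-- A map of universes commutes strictly, that is up to equality of codes, with the operations on
codes. -/
structure Hom.IsStrict {W : Univ E} (h : Hom U W) (c : U.Codes) (d : W.Codes) : Prop where
  pi : ∀ {Γ : E} (x : U.Fam Γ), c.pi x ≫ h.ty = d.pi (h.fam x)
  sigma : ∀ {Γ : E} (x : U.Fam Γ), c.sigma x ≫ h.ty = d.sigma (h.fam x)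
  eq : ∀ {Γ : E} (x : U.Pair Γ), c.eq x ≫ h.ty = d.eq (h.pair x)
  unit : c.unit ≫ h.ty = d.unit
  bool : c.bool ≫ h.ty = d.bool

end Univ

end Codes

section InductionRecursion

variable {E : Type u} [Category.{v} E] [HasFiniteLimits E]

/-- The context `Γ, g : El a → D`, given by its universal property. -/
structure FunCtx (U : Univ E) (D : E) {Γ : E} (a : Γ ⟶ U.Ty) where
  obj : E
  proj : obj ⟶ Γ
  ev : U.ext (proj ≫ a) ⟶ D
  universal : ∀ {Δ : E} (γ : Δ ⟶ Γ) (g : U.ext (γ ≫ a) ⟶ D),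
    ∃! γ' : Δ ⟶ obj, ∃ h : γ' ≫ proj = γ,
      U.extMap γ' (by rw [← h, Category.assoc]) ≫ ev = g

/-- The shape of one constructor of an inductive-recursive definition of a type `X` together with a
function `T : X → D`; the argument types are codes of `U`, and `Γ` is the context of what the shape
may depend on:
* `iota d`: no more arguments, and `T` takes the value `d` on the constructed element;
* `sigma a c`: an ordinary argument of type `El a`, on which the rest `c` depends;
* `delta a F c`: an inductive argument `g : El a → X`; the rest `c` depends on `T ∘ g : El a → D`. -/
inductive IRCode (U : Univ E) (D : E) : E → Type (max u v)
  | iota {Γ : E} (d : Γ ⟶ D) : IRCode U D Γ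
  | sigma {Γ : E} (a : Γ ⟶ U.Ty) (c : IRCode U D (U.ext a)) : IRCode U D Γ
  | delta {Γ : E} (a : Γ ⟶ U.Ty) (F : FunCtx U D a) (c : IRCode U D F.obj) : IRCode U D Γ

namespace IRCode

variable {U : Univ E} {D : E}

/-- The arguments, in context `Δ`, of a constructor of shape `c` for `T : X → D`, over a value
`γ` of the context of `c`. -/
noncomputable def Arg {X : E} (T : X ⟶ D) {Δ : E} : {Γ : E} → IRCode U D Γ → (Δ ⟶ Γ) → Type v
  | _, iota _, _ => PUnit
  | _, sigma a c, γ => Σ γ' : {γ' : Δ ⟶ U.ext a // γ' ≫ U.proj a = γ}, Arg T c γ'.1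
  | _, delta a F c, γ =>
      Σ g : U.ext (γ ≫ a) ⟶ X,
        Σ γ' : {γ' : Δ ⟶ F.obj // ∃ h : γ' ≫ F.proj = γ,
          U.extMap γ' (by rw [← h, Category.assoc]) ≫ F.ev = g ≫ T}, Arg T c γ'.1

/-- The value that `T` takes on the element constructed from the given arguments. -/
noncomputable def val {X : E} (T : X ⟶ D) {Δ : E} :
    {Γ : E} → (c : IRCode U D Γ) → {γ : Δ ⟶ Γ} → Arg T c γ → (Δ ⟶ D)
  | _, iota d, γ, _ => γ ≫ d
  | _, sigma _ c, _, x => val T c x.2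
  | _, delta _ _ c, _, x => val T c x.2.2

theorem extMap_comp {Γ Δ Θ : E} (σ : Θ ⟶ Δ) (τ : Δ ⟶ Γ) {a : Γ ⟶ U.Ty} {b : Δ ⟶ U.Ty}
    {c : Θ ⟶ U.Ty} (h : b = τ ≫ a) (h' : c = σ ≫ b) (h'' : c = (σ ≫ τ) ≫ a) :
    U.extMap σ h' ≫ U.extMap τ h = U.extMap (σ ≫ τ) h'' := by
  unfold Univ.extMap
  apply pullback.hom_ext
  · rw [Category.assoc, pullback.lift_fst, pullback.lift_fst, pullback.lift_fst_assoc,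
      Category.assoc]
  · rw [Category.assoc, pullback.lift_snd, pullback.lift_snd, pullback.lift_snd]

theorem subst_aux {X : E} (T : X ⟶ D) {Γ Δ Δ' : E} (τ : Δ' ⟶ Δ) {a : Γ ⟶ U.Ty}
    (F : FunCtx U D a) {γ : Δ ⟶ Γ} (g : U.ext (γ ≫ a) ⟶ X) {γ' : Δ ⟶ F.obj}
    (H : ∃ h : γ' ≫ F.proj = γ,
      U.extMap γ' (by rw [← h, Category.assoc]) ≫ F.ev = g ≫ T) :
    ∃ h : (τ ≫ γ') ≫ F.proj = τ ≫ γ,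
      U.extMap (τ ≫ γ') (by rw [← h, Category.assoc]) ≫ F.ev =
        (U.extMap τ (Category.assoc τ γ a) ≫ g) ≫ T := by
  obtain ⟨h, e⟩ := H
  refine ⟨by rw [Category.assoc, h], ?_⟩
  rw [Category.assoc (U.extMap τ _) g T, ← e, ← Category.assoc (U.extMap τ _), extMap_comp]

/-- Substitution in the arguments of a constructor. -/
noncomputable def subst {X : E} (T : X ⟶ D) {Δ Δ' : E} (τ : Δ' ⟶ Δ) :
    {Γ : E} → (c : IRCode U D Γ) → {γ : Δ ⟶ Γ} → Arg T c γ → Arg T c (τ ≫ γ)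
  | _, iota _, _, _ => PUnit.unit
  | _, sigma _ c, _, x =>
      ⟨⟨τ ≫ x.1.1, by rw [Category.assoc, x.1.2]⟩, subst T τ c x.2⟩
  | _, delta a F c, γ, x =>
      ⟨U.extMap τ (Category.assoc τ γ a) ≫ x.1,
        ⟨τ ≫ x.2.1.1, subst_aux T τ F x.1 x.2.1.2⟩,
        subst T τ c x.2.2⟩

/-- The action on the arguments of a constructor of a map `f : X ⟶ Y` compatible with the functions
to `D`. -/
noncomputable def map {X Y : E} {T : X ⟶ D} {S : Y ⟶ D} (f : X ⟶ Y) (hf : f ≫ S = T) {Δ : E} :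
    {Γ : E} → (c : IRCode U D Γ) → {γ : Δ ⟶ Γ} → Arg T c γ → Arg S c γ
  | _, iota _, _, _ => PUnit.unit
  | _, sigma _ c, _, x => ⟨x.1, map f hf c x.2⟩
  | _, delta _ _ c, _, x =>
      ⟨x.1 ≫ f, ⟨x.2.1.1, x.2.1.2.imp fun _ e => by rw [e, Category.assoc, hf]⟩,
        map f hf c x.2.2⟩

end IRCode

/-- For a (closed) inductive-recursive definition, given by the finite list of the shapes of its
constructors: a type `X` with a function `T : X → D` that interpret the introduction rules and the
defining equations of `T`. -/
structure IRAlg {U : Univ E} {D : E} (cs : List (IRCode U D (⊤_ E))) where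
  X : E
  T : X ⟶ D
  intro : ∀ (n : Fin cs.length) {Δ : E} {γ : Δ ⟶ ⊤_ E}, (cs.get n).Arg T γ → (Δ ⟶ X)
  intro_subst : ∀ (n : Fin cs.length) {Δ Δ' : E} (τ : Δ' ⟶ Δ) {γ : Δ ⟶ ⊤_ E}
    (x : (cs.get n).Arg T γ), τ ≫ intro n x = intro n ((cs.get n).subst T τ x)
  intro_T : ∀ (n : Fin cs.length) {Δ : E} {γ : Δ ⟶ ⊤_ E} (x : (cs.get n).Arg T γ),
    intro n x ≫ T = (cs.get n).val T x

/-- The elimination rule, in the form of initiality: there is exactly one map to any other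
interpretation of the rules. -/
def IRAlg.IsInitial {U : Univ E} {D : E} {cs : List (IRCode U D (⊤_ E))} (A : IRAlg cs) : Prop :=
  ∀ B : IRAlg cs, ∃! f : A.X ⟶ B.X, ∃ hf : f ≫ B.T = A.T,
    ∀ (n : Fin cs.length) {Δ : E} {γ : Δ ⟶ ⊤_ E} (x : (cs.get n).Arg A.T γ),
      A.intro n x ≫ f = B.intro n ((cs.get n).map f hf x)

/-- Induction-recursion in the universe `U` with values in `D`: every inductive-recursive
definition of a type `X` and a function `X → D` whose argument types are codes of `U` has a solution
with `X` in `U`. -/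
def Univ.SupportsIR (U : Univ E) (D : E) : Prop :=
  ∀ cs : List (IRCode U D (⊤_ E)),
    ∃ A : IRAlg cs, A.IsInitial ∧ U.Small (terminal.from A.X)

/-- Large induction-recursion in `U`: the recursive function may take values in any type. -/
def Univ.SupportsLargeIR (U : Univ E) : Prop :=
  ∀ D : E, U.SupportsIR D

end InductionRecursion

section Hierarchy

variable (E : Type u) [Category.{v} E] [HasFiniteLimits E] [HasFiniteCoproducts E] [LCCC E]

/-- A weakly cumulative hierarchy `U 0 : U 1 : … : U ⊤` of weak universes à la Tarski. The lifts
preserve decoded types up to isomorphism only, and are not required to commute with the codes or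
with each other. -/
structure WeakHierarchy where
  U : WithTop ℕ → Univ E
  codes : ∀ i, (U i).Codes
  isWeak : ∀ i, (codes i).IsWeak
  lift : ∀ {i j}, i < j → Univ.Hom (U i) (U j)
  small : ∀ {i j}, i < j → (U j).Small (terminal.from (U i).Ty)

variable {E}

/-- Small induction-recursion in each `U (i + 1)`: the recursive function takes values in the
next smaller universe `U i`. -/
def WeakHierarchy.SupportsSmallIR (W : WeakHierarchy E) : Prop :=
  ∀ i : ℕ, (W.U ((i + 1 : ℕ) : WithTop ℕ)).SupportsIR (W.U (i : WithTop ℕ)).Ty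

/-- A strictly cumulative hierarchy `V 0 : V 1 : …` of universes with injective codes that extends
the hierarchy `W`. Types are represented by codes of the top universe `U ⊤`, into which all `V i`
decode; every equation below is an equality of such codes or of elements of `V i`. -/
structure StrictHierarchy (W : WeakHierarchy E) where
  V : ℕ → Univ E
  /-- The decoding function of `V i`. -/
  dec : ∀ i, Univ.Hom (V i) (W.U ⊤)
  codes : ∀ i, (V i).Codes
  injective : ∀ i, (codes i).IsInjective
  /-- Decoding commutes strictly with the type formers. -/
  dec_strict : ∀ i, (dec i).IsStrict (codes i) (W.codes ⊤)
  /-- The type `V i`, as a code of `U ⊤`. -/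
  self : ℕ → (⊤_ E ⟶ (W.U ⊤).Ty)
  self_decodes : ∀ i, (W.U ⊤).Decodes (self i) (terminal.from (V i).Ty)
  /-- The code of `V k` in `V i`. -/
  uni : ∀ {k i : ℕ}, k < i → (⊤_ E ⟶ (V i).Ty)
  dec_uni : ∀ {k i : ℕ} (h : k < i), uni h ≫ (dec i).ty = self k
  /-- The strictly functorial lifts, which commute strictly with decoding and with all codes. -/
  lift : ∀ {i j : ℕ}, i ≤ j → Univ.Hom (V i) (V j)
  lift_refl : ∀ i, lift (le_refl i) = Univ.Hom.id (V i)
  lift_trans : ∀ {i j k : ℕ} (h : i ≤ j) (h' : j ≤ k),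
    (lift h).comp (lift h') = lift (h.trans h')
  lift_dec : ∀ {i j : ℕ} (h : i ≤ j), (lift h).comp (dec j) = dec i
  lift_strict : ∀ {i j : ℕ} (h : i ≤ j), (lift h).IsStrict (codes i) (codes j)
  lift_uni : ∀ {k i j : ℕ} (h : k < i) (h' : i ≤ j),
    uni h ≫ (lift h').ty = uni (h.trans_le h')
  /-- The inclusion of the original universe, which decodes as before. -/
  up : ∀ i : ℕ, Univ.Hom (W.U (i : WithTop ℕ)) (V i)
  up_dec : ∀ i : ℕ, (up i).comp (dec i) = W.lift (WithTop.coe_lt_top i)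

end Hierarchy

end TarskiUniverse

/-! `V i` is the initial universe over `U ⊤` that has strictly preserved codes for the type formers
and, as constants, names for all types of `U 0, …, U i` (decoded by the given lifts) and for the
earlier `V k`, whose codes in `U ⊤` are already chosen. Induction-recursion provides it
(`CodedUniv.exists_isInitialOver`): `X` is the type of codes and `T` their decoding. The arguments
`A : X`, `B : El (T A) → X` of a constructor are exactly a family of codes, so interpretations of
the rules are the same as universes over the base.

Everything else uses initiality. Since `V j` restricted to the constants of stage `i ≤ j` is again a
universe over `U ⊤`, there is a unique strict lift `V i → V j`, and uniqueness makes the lifts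
functorial. Codes are injective (`IsInitialOver.isInjective`): enlarge the universe by fresh names
that remember the arguments of one type former; the section given by initiality sends each such code
to the name of its arguments.

For the comparison with `U i`, form the universe `B` of triples (code of `U ⊤`, code of `U i`,
isomorphism of the decoded types). Both universes being weak, and the constants having codes in `U
i`, `B` can be given codes preserved by both projections (`CodedUniv.exists_span`). Initiality then
yields `V i → B → U i`, so every `V i`-small family is `U i`-small; the constant for `U i` gives the
converse.

With small induction-recursion, the initial universe over `U i` is constructed in `U (i + 1)`. It
maps through `B` to `U ⊤`, and initiality does not depend on the base (`IsInitialOver.change_base`),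
so it is isomorphic to `V i`. Induction makes each `V k` small in all later `U i`. -/

namespace TarskiUniverse

set_option linter.unusedSectionVars false

/-! ### Context extension, substitution and maps of universes -/

section Extension

variable {E : Type u} [Category.{v} E] [HasFiniteLimits E]

namespace Univ

variable {U W : Univ E}

theorem extMap_fst {Γ Δ : E} (τ : Δ ⟶ Γ) {a : Γ ⟶ U.Ty} {b : Δ ⟶ U.Ty} (h : b = τ ≫ a) :
    U.extMap τ h ≫ pullback.fst a U.p = pullback.fst b U.p ≫ τ :=
  pullback.lift_fst _ _ _

theorem extMap_fst_assoc {Γ Δ : E} (τ : Δ ⟶ Γ) {a : Γ ⟶ U.Ty} {b : Δ ⟶ U.Ty} (h : b = τ ≫ a)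
    {Z : E} (k : Γ ⟶ Z) :
    U.extMap τ h ≫ pullback.fst a U.p ≫ k = pullback.fst b U.p ≫ τ ≫ k := by
  rw [← Category.assoc, extMap_fst, Category.assoc]

theorem extMap_snd {Γ Δ : E} (τ : Δ ⟶ Γ) {a : Γ ⟶ U.Ty} {b : Δ ⟶ U.Ty} (h : b = τ ≫ a) :
    U.extMap τ h ≫ pullback.snd a U.p = pullback.snd b U.p :=
  pullback.lift_snd _ _ _

theorem extMap_snd_assoc {Γ Δ : E} (τ : Δ ⟶ Γ) {a : Γ ⟶ U.Ty} {b : Δ ⟶ U.Ty} (h : b = τ ≫ a)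
    {Z : E} (k : U.El ⟶ Z) :
    U.extMap τ h ≫ pullback.snd a U.p ≫ k = pullback.snd b U.p ≫ k := by
  rw [← Category.assoc, extMap_snd]

theorem extMap_trans {Γ Δ Θ : E} (σ : Θ ⟶ Δ) (τ : Δ ⟶ Γ) {a : Γ ⟶ U.Ty} {b : Δ ⟶ U.Ty}
    {c : Θ ⟶ U.Ty} (h : b = τ ≫ a) (h' : c = σ ≫ b) :
    U.extMap σ h' ≫ U.extMap τ h = U.extMap (σ ≫ τ) (by rw [h', h, Category.assoc]) :=
  IRCode.extMap_comp σ τ h h' _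

theorem extMap_trans_assoc {Γ Δ Θ : E} (σ : Θ ⟶ Δ) (τ : Δ ⟶ Γ) {a : Γ ⟶ U.Ty} {b : Δ ⟶ U.Ty}
    {c : Θ ⟶ U.Ty} (h : b = τ ≫ a) (h' : c = σ ≫ b) {Z : E} (k : U.ext a ⟶ Z) :
    U.extMap σ h' ≫ U.extMap τ h ≫ k =
      U.extMap (σ ≫ τ) (by rw [h', h, Category.assoc]) ≫ k := by
  rw [← Category.assoc, extMap_trans]

@[simp]
theorem extMap_id {Γ : E} (a : Γ ⟶ U.Ty) (h : a = 𝟙 Γ ≫ a) : U.extMap (𝟙 Γ) h = 𝟙 _ := by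
  apply pullback.hom_ext
  · rw [extMap_fst, Category.comp_id, Category.id_comp]
  · rw [extMap_snd, Category.id_comp]

theorem extMap_congr {Γ Δ : E} {τ τ' : Δ ⟶ Γ} (e : τ = τ') {a : Γ ⟶ U.Ty} {b : Δ ⟶ U.Ty}
    (h : b = τ ≫ a) (h' : b = τ' ≫ a) : U.extMap τ h = U.extMap τ' h' := by
  subst e; rfl

/-- Substitution squares between extended contexts are cartesian. -/
theorem isPullback_extMap {Γ Δ : E} (τ : Δ ⟶ Γ) {a : Γ ⟶ U.Ty} {b : Δ ⟶ U.Ty} (h : b = τ ≫ a) :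
    IsPullback (U.extMap τ h) (U.proj b) (U.proj a) τ := by
  refine IsPullback.of_right (h₁₂ := pullback.snd a U.p) (h₂₂ := a) (v₁₃ := U.p) ?_
    (extMap_fst τ h) (IsPullback.of_hasPullback a U.p).flip
  rw [extMap_snd]
  subst h
  exact (IsPullback.of_hasPullback (τ ≫ a) U.p).flip

/-- The type of `cod` depends on `dom`. Substitution along `𝟙 Γ` plays the role of transport along
`d = d'`, so that equalities of families can be proved by composing morphisms. -/
theorem Fam.mk_eq_mk {Γ : E} {d d' : Γ ⟶ U.Ty} {c : U.ext d ⟶ U.Ty} {c' : U.ext d' ⟶ U.Ty}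
    (hd : d' = 𝟙 Γ ≫ d) (hc : U.extMap (𝟙 Γ) hd ≫ c = c') : (⟨d, c⟩ : U.Fam Γ) = ⟨d', c'⟩ := by
  obtain rfl : d = d' := by rw [hd, Category.id_comp]
  rw [extMap_id, Category.id_comp] at hc
  obtain rfl : c = c' := hc
  rfl

/-- Maps into an extended context may be compared after a map of universes. -/
theorem Hom.ext_hom_ext (h : Hom U W) {Γ Z : E} {a : Γ ⟶ U.Ty} {f g : Z ⟶ U.ext a}
    (h₁ : f ≫ pullback.fst a U.p = g ≫ pullback.fst a U.p)
    (h₂ : f ≫ pullback.snd a U.p ≫ h.el = g ≫ pullback.snd a U.p ≫ h.el) : f = g := by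
  apply pullback.hom_ext h₁
  apply h.isPullback.hom_ext
  · simpa using h₂
  · rw [Category.assoc, Category.assoc, ← pullback.condition, reassoc_of% h₁]

/-- The comparison of the extensions of a context by a code and by its image under a map of
universes. -/
noncomputable def Hom.extIso (h : Hom U W) {Γ : E} {a : Γ ⟶ U.Ty} {b : Γ ⟶ W.Ty}
    (e : b = a ≫ h.ty) : W.ext b ≅ U.ext a where
  hom := pullback.lift (pullback.fst b W.p)
    (h.isPullback.lift (pullback.snd b W.p) (pullback.fst b W.p ≫ a)
      (by rw [Category.assoc, ← e, pullback.condition]))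
    (by rw [IsPullback.lift_snd])
  inv := pullback.lift (pullback.fst a U.p) (pullback.snd a U.p ≫ h.el)
    (by rw [e, Category.assoc, h.isPullback.w, pullback.condition_assoc])
  hom_inv_id := by
    apply pullback.hom_ext
    · rw [Category.assoc, pullback.lift_fst, pullback.lift_fst, Category.id_comp]
    · rw [Category.assoc, pullback.lift_snd, pullback.lift_snd_assoc, IsPullback.lift_fst,
        Category.id_comp]
  inv_hom_id := by
    apply h.ext_hom_ext
    · rw [Category.assoc, pullback.lift_fst, pullback.lift_fst, Category.id_comp]
    · rw [Category.assoc, pullback.lift_snd_assoc, IsPullback.lift_fst, pullback.lift_snd,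
        Category.id_comp]

@[simp]
theorem Hom.extIso_hom_fst (h : Hom U W) {Γ : E} {a : Γ ⟶ U.Ty} {b : Γ ⟶ W.Ty}
    (e : b = a ≫ h.ty) : (h.extIso e).hom ≫ pullback.fst a U.p = pullback.fst b W.p :=
  pullback.lift_fst _ _ _

@[simp]
theorem Hom.extIso_hom_fst_assoc (h : Hom U W) {Γ : E} {a : Γ ⟶ U.Ty} {b : Γ ⟶ W.Ty}
    (e : b = a ≫ h.ty) {Z : E} (k : Γ ⟶ Z) :
    (h.extIso e).hom ≫ pullback.fst a U.p ≫ k = pullback.fst b W.p ≫ k := by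
  rw [← h.extIso_hom_fst e]
  simp only [Category.assoc]

@[simp]
theorem Hom.extIso_hom_snd_el (h : Hom U W) {Γ : E} {a : Γ ⟶ U.Ty} {b : Γ ⟶ W.Ty}
    (e : b = a ≫ h.ty) : (h.extIso e).hom ≫ pullback.snd a U.p ≫ h.el = pullback.snd b W.p :=
  (pullback.lift_snd_assoc _ _ _ _).trans (IsPullback.lift_fst _ _ _ _)

@[simp]
theorem Hom.extIso_hom_snd_el_assoc (h : Hom U W) {Γ : E} {a : Γ ⟶ U.Ty} {b : Γ ⟶ W.Ty}
    (e : b = a ≫ h.ty) {Z : E} (k : W.El ⟶ Z) :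
    (h.extIso e).hom ≫ pullback.snd a U.p ≫ h.el ≫ k = pullback.snd b W.p ≫ k := by
  rw [← h.extIso_hom_snd_el e]
  simp only [Category.assoc]

/-- The comparison of extended contexts is natural. -/
theorem Hom.extIso_hom_extMap (h : Hom U W) {Γ Δ : E} (τ : Δ ⟶ Γ) {a : Γ ⟶ U.Ty} {b : Γ ⟶ W.Ty}
    (e : b = a ≫ h.ty) {a' : Δ ⟶ U.Ty} {b' : Δ ⟶ W.Ty} (e' : b' = a' ≫ h.ty)
    (ha : a' = τ ≫ a) (hb : b' = τ ≫ b) :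
    (h.extIso e').hom ≫ U.extMap τ ha = W.extMap τ hb ≫ (h.extIso e).hom := by
  apply h.ext_hom_ext
  · simp [extMap_fst]
  · simp [extMap_snd, extMap_snd_assoc]

theorem Hom.extIso_hom_extMap_assoc (h : Hom U W) {Γ Δ : E} (τ : Δ ⟶ Γ) {a : Γ ⟶ U.Ty}
    {b : Γ ⟶ W.Ty} (e : b = a ≫ h.ty) {a' : Δ ⟶ U.Ty} {b' : Δ ⟶ W.Ty} (e' : b' = a' ≫ h.ty)
    (ha : a' = τ ≫ a) (hb : b' = τ ≫ b) {Z : E} (k : U.ext a ⟶ Z) :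
    (h.extIso e').hom ≫ U.extMap τ ha ≫ k = W.extMap τ hb ≫ (h.extIso e).hom ≫ k := by
  rw [← Category.assoc, h.extIso_hom_extMap τ e e' ha hb, Category.assoc]

theorem Hom.extIso_hom_comp {V : Univ E} (k : Hom V U) (h : Hom U W) {Γ : E} {a : Γ ⟶ V.Ty}
    {b : Γ ⟶ U.Ty} {c : Γ ⟶ W.Ty} (e : b = a ≫ k.ty) (e' : c = b ≫ h.ty)
    (e₂ : c = a ≫ (k.comp h).ty) :
    (h.extIso e').hom ≫ (k.extIso e).hom = ((k.comp h).extIso e₂).hom := by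
  apply (k.comp h).ext_hom_ext
  · simp
  · have := (k.comp h).extIso_hom_snd_el e₂
    rw [this]
    simp [Hom.comp]

theorem Hom.extIso_hom_comp_assoc {V : Univ E} (k : Hom V U) (h : Hom U W) {Γ : E} {a : Γ ⟶ V.Ty}
    {b : Γ ⟶ U.Ty} {c : Γ ⟶ W.Ty} (e : b = a ≫ k.ty) (e' : c = b ≫ h.ty)
    (e₂ : c = a ≫ (k.comp h).ty) {Z : E} (f : V.ext a ⟶ Z) :
    (h.extIso e').hom ≫ (k.extIso e).hom ≫ f = ((k.comp h).extIso e₂).hom ≫ f := by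
  rw [← Category.assoc, k.extIso_hom_comp h e e' e₂]

theorem Hom.extIso_id_hom {Γ : E} {a b : Γ ⟶ U.Ty} (e : b = a ≫ (Hom.id U).ty) :
    ((Hom.id U).extIso e).hom = U.extMap (𝟙 Γ) (by rw [e]; simp [Hom.id]) := by
  apply (Hom.id U).ext_hom_ext
  · simp [extMap_fst]
  · rw [Hom.extIso_hom_snd_el]; simp [Hom.id, extMap_snd]

theorem Fam.subst_subst {Γ Δ Θ : E} (σ : Θ ⟶ Δ) (τ : Δ ⟶ Γ) (x : U.Fam Γ) :
    (x.subst τ).subst σ = x.subst (σ ≫ τ) := by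
  refine Fam.mk_eq_mk (d := σ ≫ τ ≫ x.dom) (d' := (σ ≫ τ) ≫ x.dom)
    (c := U.extMap σ rfl ≫ U.extMap τ rfl ≫ x.cod) (by simp) ?_
  rw [extMap_trans_assoc, extMap_trans_assoc]
  congr 1
  apply extMap_congr
  simp

theorem Pair.subst_subst {Γ Δ Θ : E} (σ : Θ ⟶ Δ) (τ : Δ ⟶ Γ) (x : U.Pair Γ) :
    (x.subst τ).subst σ = x.subst (σ ≫ τ) := by
  simp [Pair.subst]

theorem Hom.fam_subst (h : Hom U W) {Γ Δ : E} (τ : Δ ⟶ Γ) (x : U.Fam Γ) :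
    h.fam (x.subst τ) = (h.fam x).subst τ := by
  refine Fam.mk_eq_mk (d := (τ ≫ x.dom) ≫ h.ty) (d' := τ ≫ x.dom ≫ h.ty)
    (c := (h.extIso rfl).hom ≫ (U.extMap τ rfl ≫ x.cod) ≫ h.ty)
    (c' := W.extMap τ rfl ≫ (h.extIso rfl).hom ≫ x.cod ≫ h.ty) (by simp) ?_
  rw [Category.assoc (U.extMap τ rfl), h.extIso_hom_extMap_assoc τ rfl rfl rfl (by simp),
    extMap_trans_assoc]
  congr 1
  apply extMap_congr
  simp

theorem Hom.fam_comp {V : Univ E} (k : Hom V U) (h : Hom U W) {Γ : E} (x : V.Fam Γ) :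
    (k.comp h).fam x = h.fam (k.fam x) := by
  have e : (x.dom ≫ k.ty) ≫ h.ty = x.dom ≫ (k.comp h).ty := Category.assoc _ _ _
  refine Fam.mk_eq_mk (d := x.dom ≫ (k.comp h).ty) (d' := (x.dom ≫ k.ty) ≫ h.ty)
    (c := ((k.comp h).extIso rfl).hom ≫ x.cod ≫ (k.comp h).ty)
    (c' := (h.extIso rfl).hom ≫ ((k.extIso rfl).hom ≫ x.cod ≫ k.ty) ≫ h.ty)
    (by rw [e, Category.id_comp]) ?_
  have := (k.comp h).extIso_hom_extMap_assoc (𝟙 Γ) (a := x.dom) rfl e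
    (Category.id_comp _).symm (by rw [e, Category.id_comp]) (x.cod ≫ (k.comp h).ty)
  refine this.symm.trans ?_
  rw [extMap_id, Category.id_comp, Category.assoc (k.extIso rfl).hom,
    Hom.extIso_hom_comp_assoc k h rfl rfl e, Category.assoc x.cod]
  rfl

theorem Hom.fam_id {Γ : E} (x : U.Fam Γ) : (Hom.id U).fam x = x := by
  refine Fam.mk_eq_mk (d := x.dom ≫ 𝟙 _) (d' := x.dom)
    (c := ((Hom.id U).extIso rfl).hom ≫ x.cod ≫ 𝟙 _) (by simp) ?_
  rw [extIso_id_hom]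
  refine (extMap_trans_assoc _ _ _ _ _).trans ?_
  rw [extMap_congr (Category.id_comp (𝟙 Γ)) _ (by simp), extMap_id, Category.id_comp,
    Category.comp_id]

theorem Hom.pair_subst (h : Hom U W) {Γ Δ : E} (τ : Δ ⟶ Γ) (x : U.Pair Γ) :
    h.pair (x.subst τ) = (h.pair x).subst τ := by
  simp [Hom.pair, Pair.subst]

theorem Hom.pair_comp {V : Univ E} (k : Hom V U) (h : Hom U W) {Γ : E} (x : V.Pair Γ) :
    (k.comp h).pair x = h.pair (k.pair x) := by
  simp [Hom.pair, Hom.comp]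

theorem Hom.pair_id {Γ : E} (x : U.Pair Γ) : (Hom.id U).pair x = x := by
  simp [Hom.pair, Hom.id]

theorem Hom.comp_assoc {V X : Univ E} (k : Hom V U) (h : Hom U W) (l : Hom W X) :
    (k.comp h).comp l = k.comp (h.comp l) := by
  simp [Hom.comp]

theorem Hom.id_comp (h : Hom U W) : (Hom.id U).comp h = h := by
  simp [Hom.comp, Hom.id]

/-- A map of codes over a universe underlies a unique map of universes over it. -/
noncomputable def Hom.ofTy {V : Univ E} (h : Hom V W) (k : Hom U W) (f : V.Ty ⟶ U.Ty)
    (w : f ≫ k.ty = h.ty) : Hom V U where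
  ty := f
  el := k.isPullback.lift h.el (V.p ≫ f) (by rw [Category.assoc, w, h.isPullback.w])
  isPullback := by
    refine IsPullback.of_right (h₁₂ := k.el) (h₂₂ := k.ty) (v₁₃ := W.p) ?_
      (IsPullback.lift_snd _ _ _ _) k.isPullback
    rw [IsPullback.lift_fst, w]
    exact h.isPullback

theorem Hom.ofTy_comp {V : Univ E} (h : Hom V W) (k : Hom U W) (f : V.Ty ⟶ U.Ty)
    (w : f ≫ k.ty = h.ty) : (h.ofTy k f w).comp k = h := by
  apply Hom.ext
  · exact w
  · exact IsPullback.lift_fst _ _ _ _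

/-- The square of `k` is cartesian, hence over a fixed universe the component `el` is determined by
`ty`. -/
theorem Hom.ext_of_comp {V : Univ E} {f g : Hom V U} (k : Hom U W) (w : f.comp k = g.comp k)
    (e : f.ty = g.ty) : f = g := by
  apply Hom.ext e
  apply k.isPullback.hom_ext
  · exact congrArg Hom.el w
  · rw [f.isPullback.w, g.isPullback.w, e]

/-- The universe with a given object of names for codes of `W`. -/
noncomputable def restrict (W : Univ E) {X : E} (T : X ⟶ W.Ty) : Univ E where
  Ty := X
  El := W.ext T
  p := W.proj T

/-- The decoding of `W.restrict T`. -/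
noncomputable def restrictHom (W : Univ E) {X : E} (T : X ⟶ W.Ty) : Hom (W.restrict T) W where
  ty := T
  el := pullback.snd T W.p
  isPullback := (IsPullback.of_hasPullback T W.p).flip

theorem Decodes.subst {X Γ Δ Y : E} {a : Γ ⟶ U.Ty} {f : X ⟶ Γ} (h : U.Decodes a f) {τ : Δ ⟶ Γ}
    {t : Y ⟶ X} {g : Y ⟶ Δ} (hp : IsPullback t g f τ) : U.Decodes (τ ≫ a) g := by
  obtain ⟨s, hs⟩ := h
  exact ⟨_, hp.paste_horiz hs⟩

theorem decodes_proj {Γ : E} (a : Γ ⟶ U.Ty) : U.Decodes a (U.proj a) :=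
  ⟨_, (IsPullback.of_hasPullback a U.p).flip⟩

theorem Decodes.of_iso {X Y Γ : E} {a : Γ ⟶ U.Ty} {f : X ⟶ Γ} (h : U.Decodes a f) (e : Y ≅ X)
    {g : Y ⟶ Γ} (w : e.hom ≫ f = g) : U.Decodes a g := by
  obtain ⟨s, hs⟩ := h
  exact ⟨e.hom ≫ s, hs.of_iso e.symm (Iso.refl _) (Iso.refl _) (Iso.refl _) (by simp)
    (by simp [← w]) (by simp) (by simp)⟩

/-- Two families with the same code are isomorphic. -/
theorem Decodes.exists_iso {X Y Γ : E} {a : Γ ⟶ U.Ty} {f : X ⟶ Γ} {g : Y ⟶ Γ}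
    (h : U.Decodes a f) (h' : U.Decodes a g) : ∃ e : Y ≅ X, e.hom ≫ f = g := by
  obtain ⟨s, hs⟩ := h
  obtain ⟨t, ht⟩ := h'
  exact ⟨ht.isoIsPullback _ _ hs, by simp⟩

/-- The family `f` is only an intermediary: codes of two universes that decode to a common family
decode to each other's families. -/
theorem Decodes.proj {X Γ : E} {a : Γ ⟶ U.Ty} {b : Γ ⟶ W.Ty} {f : X ⟶ Γ}
    (h : U.Decodes a f) (h' : W.Decodes b f) : W.Decodes b (U.proj a) := by
  obtain ⟨e, he⟩ := h.exists_iso (decodes_proj a)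
  exact h'.of_iso e he

theorem Hom.decodes (h : Hom U W) {X Γ : E} {a : Γ ⟶ U.Ty} {f : X ⟶ Γ} (hf : U.Decodes a f) :
    W.Decodes (a ≫ h.ty) f := by
  obtain ⟨s, hs⟩ := hf
  exact ⟨_, hs.paste_horiz h.isPullback⟩

theorem Hom.small (h : Hom U W) {X Γ : E} {f : X ⟶ Γ} (hf : U.Small f) : W.Small f := by
  obtain ⟨a, ha⟩ := hf
  exact ⟨_, h.decodes ha⟩

end Univ

end Extension

end TarskiUniverse

namespace TarskiUniverse

/-! ### Consequences of local cartesian closure -/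

section DependentProducts

variable {E : Type u} [Category.{v} E] [HasFiniteLimits E] [LCCC E]

namespace Univ

variable {U W : Univ E}

/-- The context `Γ, s : Π x : El a. Z x`, given by its universal property. -/
theorem exists_piCtx {Γ Z : E} (a : Γ ⟶ U.Ty) (z : Z ⟶ U.ext a) :
    ∃ (P : E) (π : P ⟶ Γ) (ev : U.ext (π ≫ a) ⟶ Z), ev ≫ z = U.extMap π rfl ∧
      ∀ {Δ : E} (γ : Δ ⟶ Γ) (s : U.ext (γ ≫ a) ⟶ Z), s ≫ z = U.extMap γ rfl →
        ∃! δ : Δ ⟶ P, ∃ h : δ ≫ π = γ,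
          U.extMap δ (by rw [← h, Category.assoc]) ≫ ev = s := by
  let q := U.proj a
  let adj := Adjunction.ofIsLeftAdjoint (Over.pullback q)
  -- The functor `Over.pullback q` sends `γ` to `pullback γ q`, whereas the claim is about `U.ext (γ
  -- ≫ a)`. Both are pullbacks of `q` along `γ`.
  let κ : ∀ {Δ : E} (γ : Δ ⟶ Γ), U.ext (γ ≫ a) ≅ pullback γ q := fun γ =>
    (isPullback_extMap (U := U) γ rfl).flip.isoPullback
  have κ_fst : ∀ {Δ : E} (γ : Δ ⟶ Γ), (κ γ).hom ≫ pullback.fst γ q = U.proj (γ ≫ a) :=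
    fun γ => IsPullback.isoPullback_hom_fst _
  have κ_snd : ∀ {Δ : E} (γ : Δ ⟶ Γ), (κ γ).hom ≫ pullback.snd γ q = U.extMap γ rfl :=
    fun γ => IsPullback.isoPullback_hom_snd _
  let R := (Over.pullback q).rightAdjoint.obj (Over.mk z)
  let c : (Over.pullback q).obj R ⟶ Over.mk z := adj.counit.app (Over.mk z)
  have hc : c.left ≫ z = pullback.snd R.hom q := Over.w c
  refine ⟨R.left, R.hom, (κ R.hom).hom ≫ c.left, ?_, ?_⟩
  · exact (Category.assoc _ _ _).trans ((congrArg _ hc).trans (κ_snd _))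
  intro Δ γ s hs
  -- Up to `κ`, evaluation after substituting `δ` is the transpose of `δ` under the adjunction, so
  -- the universal property becomes the bijectivity of transposition.
  have key : ∀ (δ : Δ ⟶ R.left) (h : δ ≫ R.hom = γ),
      U.extMap δ (by rw [← h, Category.assoc]) ≫ (κ R.hom).hom ≫ c.left =
        (κ γ).hom ≫ ((adj.homEquiv (Over.mk γ) (Over.mk z)).symm (Over.homMk δ h)).left := by
    intro δ h
    have e : ((adj.homEquiv (Over.mk γ) (Over.mk z)).symm (Over.homMk δ h)).left =
        pullback.lift (pullback.fst γ q ≫ δ) (pullback.snd γ q)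
          (by rw [Category.assoc, h, pullback.condition]) ≫ c.left := by
      rw [Adjunction.homEquiv_counit]
      rfl
    rw [e, ← Category.assoc (U.extMap δ _), ← Category.assoc (κ γ).hom]
    congr 1
    apply pullback.hom_ext
    · rw [Category.assoc (U.extMap δ _), Category.assoc (κ γ).hom, pullback.lift_fst, κ_fst,
        extMap_fst, ← Category.assoc (κ γ).hom, κ_fst γ]
    · rw [Category.assoc (U.extMap δ _), Category.assoc (κ γ).hom, pullback.lift_snd, κ_snd, κ_snd,
        extMap_trans]
      exact extMap_congr h _ _
  have hs' : ((κ γ).inv ≫ s) ≫ z = pullback.snd γ q := by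
    rw [Category.assoc, hs, ← κ_snd, Iso.inv_hom_id_assoc]
  let s' : (Over.pullback q).obj (Over.mk γ) ⟶ Over.mk z := Over.homMk ((κ γ).inv ≫ s) hs'
  let d := adj.homEquiv (Over.mk γ) (Over.mk z) s'
  refine ⟨d.left, ⟨Over.w d, ?_⟩, ?_⟩
  · have e : (Over.homMk d.left (Over.w d) : Over.mk γ ⟶ R) = d := rfl
    rw [key d.left (Over.w d), e, Equiv.symm_apply_apply]
    exact Iso.hom_inv_id_assoc _ _
  · rintro δ ⟨h, hδ⟩
    rw [key δ h] at hδ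
    have : (adj.homEquiv (Over.mk γ) (Over.mk z)).symm (Over.homMk δ h) = s' := by
      apply Over.OverMorphism.ext
      exact (cancel_epi (κ γ).hom).1 (hδ.trans (Iso.hom_inv_id_assoc _ _).symm)
    rw [Equiv.symm_apply_eq] at this
    exact congrArg CommaMorphism.left this

/-- Functions `El a → D` are the sections of the projection `U.ext a ⨯ D ⟶ U.ext a`. -/
theorem nonempty_funCtx (U : Univ E) (D : E) {Γ : E} (a : Γ ⟶ U.Ty) :
    Nonempty (FunCtx U D a) := by
  obtain ⟨P, π, ev, hev, huniv⟩ := exists_piCtx a (prod.fst : U.ext a ⨯ D ⟶ U.ext a)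
  refine ⟨⟨P, π, ev ≫ prod.snd, ?_⟩⟩
  intro Δ γ g
  obtain ⟨δ, ⟨h, hδ⟩, uniq⟩ := huniv γ (prod.lift (U.extMap γ rfl) g) (prod.lift_fst _ _)
  refine ⟨δ, ⟨h, ?_⟩, ?_⟩
  · rw [← Category.assoc, hδ, prod.lift_snd]
  · rintro δ' ⟨h', hδ'⟩
    refine uniq δ' ⟨h', ?_⟩
    apply Limits.prod.hom_ext
    · rw [Category.assoc, hev, prod.lift_fst, extMap_trans]
      exact extMap_congr h' _ _
    · rw [Category.assoc, hδ', prod.lift_snd]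

/-- Families of codes are represented by an object. -/
theorem exists_genericFam (U : Univ E) :
    ∃ (P : E) (G : U.Fam P) (name : ∀ {Γ : E}, U.Fam Γ → (Γ ⟶ P)),
      (∀ {Γ : E} (x : U.Fam Γ), G.subst (name x) = x) ∧
        ∀ {Γ : E} (σ : Γ ⟶ P), name (G.subst σ) = σ := by
  -- A family is a code `A` with a function `El A → Ty`, hence a point of the function context over
  -- `Ty` itself, where the generic code is `𝟙 U.Ty`. The substitutions along `𝟙 Γ` below absorb the
  -- composites with this identity.
  obtain ⟨F⟩ := nonempty_funCtx U U.Ty (𝟙 U.Ty)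
  have huniv : ∀ {Γ : E} (x : U.Fam Γ), ∃! σ : Γ ⟶ F.obj, ∃ h : σ ≫ F.proj = x.dom,
      U.extMap σ (a := F.proj ≫ 𝟙 _) (by rw [← h, Category.comp_id]) ≫ F.ev = x.cod := by
    intro Γ x
    obtain ⟨σ, ⟨h, hσ⟩, uniq⟩ := F.universal x.dom
      (U.extMap (𝟙 Γ) (by simp) ≫ x.cod)
    refine ⟨σ, ⟨h, ?_⟩, ?_⟩
    · have := congrArg (U.extMap (𝟙 Γ) (a := x.dom ≫ 𝟙 _) (b := x.dom) (by simp) ≫ ·) hσ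
      rw [extMap_trans_assoc, extMap_trans_assoc,
        extMap_congr (Category.id_comp (𝟙 Γ)) _ (by simp), extMap_id,
        Category.id_comp (X := U.ext x.dom)] at this
      rw [← this]
      congr 1
      exact extMap_congr (by simp) _ _
    · rintro σ' ⟨h', hσ'⟩
      refine uniq σ' ⟨h', ?_⟩
      rw [← hσ', extMap_trans_assoc]
      congr 1
      exact extMap_congr (by simp) _ _
  choose name hname using fun (Γ : E) (x : U.Fam Γ) => (huniv x).exists
  have hsub : ∀ {Γ : E} (x : U.Fam Γ) (σ : Γ ⟶ F.obj) (h : σ ≫ F.proj = x.dom),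
      U.extMap σ (a := F.proj ≫ 𝟙 _) (by rw [← h, Category.comp_id]) ≫ F.ev = x.cod ↔
        (⟨F.proj ≫ 𝟙 _, F.ev⟩ : U.Fam F.obj).subst σ = x := by
    rintro Γ ⟨d, c⟩ σ (h : σ ≫ F.proj = d)
    subst h
    have e : σ ≫ F.proj = σ ≫ F.proj ≫ 𝟙 _ := by simp
    have e' : U.extMap σ e ≫ F.ev =
        U.extMap (𝟙 Γ) (by simp) ≫ U.extMap σ (a := F.proj ≫ 𝟙 _) rfl ≫ F.ev := by
      rw [extMap_trans_assoc]
      congr 1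
      exact extMap_congr (by simp) _ _
    constructor
    · intro hc
      exact Fam.mk_eq_mk (d := σ ≫ F.proj ≫ 𝟙 _) (c := U.extMap σ rfl ≫ F.ev) (by simp)
        (e'.symm.trans hc)
    · intro hc
      have : (⟨F.proj ≫ 𝟙 _, F.ev⟩ : U.Fam F.obj).subst σ =
          ⟨σ ≫ F.proj, U.extMap σ e ≫ F.ev⟩ :=
        Fam.mk_eq_mk (d := σ ≫ F.proj ≫ 𝟙 _) (c := U.extMap σ rfl ≫ F.ev) (by simp) e'.symm
      rw [this] at hc
      simpa using hc
  have h₁ : ∀ {Γ : E} (x : U.Fam Γ),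
      (⟨F.proj ≫ 𝟙 _, F.ev⟩ : U.Fam F.obj).subst (name Γ x) = x := fun {Γ} x => by
    obtain ⟨h, h'⟩ := hname Γ x
    exact (hsub x _ h).1 h'
  refine ⟨F.obj, ⟨F.proj ≫ 𝟙 _, F.ev⟩, fun {Γ} x => name Γ x, h₁, fun {Γ} σ => ?_⟩
  have hd : σ ≫ F.proj =
      ((⟨F.proj ≫ 𝟙 _, F.ev⟩ : U.Fam F.obj).subst σ).dom := by simp [Fam.subst]
  exact (huniv _).unique (hname Γ _) ⟨hd, (hsub _ _ hd).2 rfl⟩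

/-- A substitution-stable choice for families of codes exists as soon as choices exist in every
context. -/
theorem exists_famOp (U : Univ E) {Y : E} (P : ∀ {Γ : E}, U.Fam Γ → (Γ ⟶ Y) → Prop)
    (stable : ∀ {Γ Δ : E} (τ : Δ ⟶ Γ) (x : U.Fam Γ) (y : Γ ⟶ Y), P x y → P (x.subst τ) (τ ≫ y))
    (ex : ∀ {Γ : E} (x : U.Fam Γ), ∃ y, P x y) :
    ∃ op : ∀ {Γ : E}, U.Fam Γ → (Γ ⟶ Y),
      (∀ {Γ Δ : E} (τ : Δ ⟶ Γ) (x : U.Fam Γ), τ ≫ op x = op (x.subst τ)) ∧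
        ∀ {Γ : E} (x : U.Fam Γ), P x (op x) := by
  -- A single choice is made, for the generic family; all other values are substituted from it,
  -- which forces stability.
  obtain ⟨Q, G, name, h₁, h₂⟩ := exists_genericFam U
  obtain ⟨y, hy⟩ := ex G
  refine ⟨fun x => name x ≫ y, fun τ x => ?_, fun x => ?_⟩
  · change τ ≫ name x ≫ y = name (x.subst τ) ≫ y
    have : name (x.subst τ) = τ ≫ name x := by
      rw [← h₂ (τ ≫ name x), ← Fam.subst_subst, h₁]
    rw [← Category.assoc, this]
  · have := stable (name x) G y hy
    rwa [h₁] at this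

/-- Pairs of elements of the same code are represented by an object. -/
theorem exists_genericPair {E : Type u} [Category.{v} E] [HasFiniteLimits E]
    (U : Univ E) :
    ∃ (P : E) (G : U.Pair P) (name : ∀ {Γ : E}, U.Pair Γ → (Γ ⟶ P)),
      (∀ {Γ : E} (x : U.Pair Γ), G.subst (name x) = x) ∧
        ∀ {Γ : E} (σ : Γ ⟶ P), name (G.subst σ) = σ := by
  refine ⟨pullback U.p U.p, ⟨pullback.fst _ _, pullback.snd _ _, pullback.condition⟩,
    fun x => pullback.lift x.lhs x.rhs x.eq, fun x => ?_, fun σ => ?_⟩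
  · apply Pair.ext
    · exact pullback.lift_fst _ _ _
    · exact pullback.lift_snd _ _ _
  · apply pullback.hom_ext
    · exact pullback.lift_fst _ _ _
    · exact pullback.lift_snd _ _ _

/-- A substitution-stable choice for pairs of elements exists as soon as choices exist in every
context. -/
theorem exists_pairOp {E : Type u} [Category.{v} E] [HasFiniteLimits E] (U : Univ E)
    {Y : E} (P : ∀ {Γ : E}, U.Pair Γ → (Γ ⟶ Y) → Prop)
    (stable : ∀ {Γ Δ : E} (τ : Δ ⟶ Γ) (x : U.Pair Γ) (y : Γ ⟶ Y), P x y → P (x.subst τ) (τ ≫ y))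
    (ex : ∀ {Γ : E} (x : U.Pair Γ), ∃ y, P x y) :
    ∃ op : ∀ {Γ : E}, U.Pair Γ → (Γ ⟶ Y),
      (∀ {Γ Δ : E} (τ : Δ ⟶ Γ) (x : U.Pair Γ), τ ≫ op x = op (x.subst τ)) ∧
        ∀ {Γ : E} (x : U.Pair Γ), P x (op x) := by
  obtain ⟨Q, G, name, h₁, h₂⟩ := exists_genericPair U
  obtain ⟨y, hy⟩ := ex G
  refine ⟨fun x => name x ≫ y, fun τ x => ?_, fun x => ?_⟩
  · change τ ≫ name x ≫ y = name (x.subst τ) ≫ y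
    have : name (x.subst τ) = τ ≫ name x := by
      rw [← h₂ (τ ≫ name x), ← Pair.subst_subst, h₁]
    rw [← Category.assoc, this]
  · have := stable (name x) G y hy
    rwa [h₁] at this

end Univ

/-- In a locally cartesian closed category, the coproduct injections are monomorphisms. -/
theorem mono_coprod_inl [HasFiniteCoproducts E] (A B : E) :
    Mono (coprod.inl : A ⟶ A ⨿ B) := by
  refine ⟨fun {Z} f g h => ?_⟩
  -- The only closed type of this universe is `Z`, so `F.obj` is the exponential `A ^ Z` and `lam`
  -- is currying.
  let V : Univ E := ⟨⊤_ E, Z, terminal.from Z⟩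
  obtain ⟨F⟩ := Univ.nonempty_funCtx V A (𝟙 (⊤_ E))
  have lam : ∀ {Y : E} (m : Y ⨯ Z ⟶ A), ∃ n : Y ⟶ F.obj, ∀ (y : Z ⟶ Y),
      prod.lift y (𝟙 Z) ≫ m = pullback.lift (y ≫ n) (𝟙 Z) (Subsingleton.elim _ _) ≫ F.ev := by
    intro Y m
    obtain ⟨n, ⟨h, hn⟩, -⟩ := F.universal (terminal.from Y)
      (prod.lift (V.proj _) (pullback.snd (terminal.from Y ≫ 𝟙 _) V.p) ≫ m)
    refine ⟨n, fun y => ?_⟩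
    have e : pullback.lift (f := terminal.from Y ≫ 𝟙 _) (g := V.p) y (𝟙 Z)
        (Subsingleton.elim _ _) ≫ V.extMap n (a := F.proj ≫ 𝟙 _) (Subsingleton.elim _ _) =
          pullback.lift (y ≫ n) (𝟙 Z) (Subsingleton.elim _ _) := by
      apply pullback.hom_ext
      · rw [Category.assoc, Univ.extMap_fst, pullback.lift_fst, pullback.lift_fst_assoc]
      · rw [Category.assoc, Univ.extMap_snd, pullback.lift_snd, pullback.lift_snd]
    rw [← e, Category.assoc, hn, ← Category.assoc]
    congr 1
    apply Limits.prod.hom_ext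
    · rw [prod.lift_fst, Category.assoc, prod.lift_fst, pullback.lift_fst]
    · rw [prod.lift_snd, Category.assoc, prod.lift_snd, pullback.lift_snd]
  -- `n₁` sends an element of `A` to the constant function. Any map from `B` to the exponential
  -- extends `n₁` to the coproduct, and `f` supplies one. Hence `f` and `g` agree after `n₁`, and
  -- evaluation recovers them.
  obtain ⟨n₁, hn₁⟩ := lam (prod.fst : A ⨯ Z ⟶ A)
  obtain ⟨n₂, -⟩ := lam (prod.snd ≫ f : B ⨯ Z ⟶ A)
  have hf := hn₁ f
  have hg := hn₁ g
  rw [prod.lift_fst] at hf hg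
  rw [hf, hg]
  congr 1
  apply pullback.hom_ext
  · rw [pullback.lift_fst, pullback.lift_fst]
    rw [← coprod.inl_desc n₁ n₂, reassoc_of% h]
  · rw [pullback.lift_snd, pullback.lift_snd]

end DependentProducts

end TarskiUniverse

namespace TarskiUniverse

/-! ### Universes with strictly preserved codes, and initiality -/

section CodedUniverses

variable {E : Type u} [Category.{v} E] [HasFiniteLimits E]

/-- A universe with codes and with further families of constant codes, indexed by the objects
`K j`. -/
structure CodedUniv {J : Type} (K : J → E) where
  U : Univ E
  codes : U.Codes
  const : ∀ j, K j ⟶ U.Ty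

namespace CodedUniv

variable {J : Type} {K : J → E}

/-- A map of universes that strictly preserves all codes. -/
structure IsHom (A B : CodedUniv K) (f : Univ.Hom A.U B.U) : Prop where
  strict : f.IsStrict A.codes B.codes
  const : ∀ j, A.const j ≫ f.ty = B.const j

theorem IsHom.id (A : CodedUniv K) : IsHom A A (Univ.Hom.id A.U) where
  strict :=
    { pi := fun x => by rw [Univ.Hom.fam_id]; exact Category.comp_id _
      sigma := fun x => by rw [Univ.Hom.fam_id]; exact Category.comp_id _
      eq := fun x => by rw [Univ.Hom.pair_id]; exact Category.comp_id _
      unit := Category.comp_id _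
      bool := Category.comp_id _ }
  const _ := Category.comp_id _

theorem IsHom.comp {A B C : CodedUniv K} {f : Univ.Hom A.U B.U} {g : Univ.Hom B.U C.U}
    (hf : IsHom A B f) (hg : IsHom B C g) : IsHom A C (f.comp g) where
  strict :=
    { pi := fun x => by
        rw [Univ.Hom.fam_comp, ← hg.strict.pi, ← hf.strict.pi, Category.assoc]; rfl
      sigma := fun x => by
        rw [Univ.Hom.fam_comp, ← hg.strict.sigma, ← hf.strict.sigma, Category.assoc]; rfl
      eq := fun x => by
        rw [Univ.Hom.pair_comp, ← hg.strict.eq, ← hf.strict.eq, Category.assoc]; rfl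
      unit := by rw [← hg.strict.unit, ← hf.strict.unit, Category.assoc]; rfl
      bool := by rw [← hg.strict.bool, ← hf.strict.bool, Category.assoc]; rfl }
  const j := by rw [← hg.const, ← hf.const, Category.assoc]; rfl

/-- `h : A ⟶ B` is initial among the universes over `B` with strictly preserved codes. -/
structure IsInitialOver (A B : CodedUniv K) (h : Univ.Hom A.U B.U) : Prop where
  isHom : IsHom A B h
  exists_hom : ∀ (C : CodedUniv K) (k : Univ.Hom C.U B.U), IsHom C B k →
    ∃ f : Univ.Hom A.U C.U, IsHom A C f ∧ f.comp k = h
  hom_ext : ∀ (C : CodedUniv K) (k : Univ.Hom C.U B.U), IsHom C B k →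
    ∀ f g : Univ.Hom A.U C.U, IsHom A C f → IsHom A C g → f.comp k = h → g.comp k = h → f = g

/-- This is the elimination principle: regard `C` as a universe over `B` through `h`. The mediating
map followed by `r` and the identity are both endomorphisms of `A` over `B`, hence equal. -/
theorem IsInitialOver.exists_section {A B : CodedUniv K} {h : Univ.Hom A.U B.U}
    (hA : IsInitialOver A B h) {C : CodedUniv K} {r : Univ.Hom C.U A.U} (hr : IsHom C A r) :
    ∃ s : Univ.Hom A.U C.U, IsHom A C s ∧ s.comp r = Univ.Hom.id A.U := by
  obtain ⟨s, hs, e⟩ := hA.exists_hom C (r.comp h) (hr.comp hA.isHom)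
  exact ⟨s, hs, hA.hom_ext A h hA.isHom _ _ (hs.comp hr) (IsHom.id A)
    (by rw [Univ.Hom.comp_assoc, e]) (Univ.Hom.id_comp h)⟩

/-- Only the objects of codes have to be pulled back; since maps of universes are cartesian, the
decoded types can be taken from `A`. -/
theorem _root_.TarskiUniverse.Univ.exists_isPullback {A B C : Univ E} (f : Univ.Hom A B)
    (g : Univ.Hom C B) :
    ∃ (P : Univ E) (p₁ : Univ.Hom P A) (p₂ : Univ.Hom P C), p₁.comp f = p₂.comp g ∧
      IsPullback p₁.ty p₂.ty f.ty g.ty :=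
  ⟨A.restrict (pullback.fst f.ty g.ty), A.restrictHom _,
    ((A.restrictHom _).comp f).ofTy g (pullback.snd f.ty g.ty) pullback.condition.symm,
    (Univ.Hom.ofTy_comp _ _ _ _).symm, IsPullback.of_hasPullback _ _⟩

/-- Codes on the pullback are pairs of codes; strictness of `f` and `g` is what makes the two
components agree over `B`. -/
theorem exists_pullback {A B C : CodedUniv K} {f : Univ.Hom A.U B.U} {g : Univ.Hom C.U B.U}
    (hf : IsHom A B f) (hg : IsHom C B g) :
    ∃ (P : CodedUniv K) (p₁ : Univ.Hom P.U A.U) (p₂ : Univ.Hom P.U C.U),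
      IsHom P A p₁ ∧ IsHom P C p₂ ∧ p₁.comp f = p₂.comp g ∧
        ∀ (D : CodedUniv K) (s : Univ.Hom D.U A.U) (t : Univ.Hom D.U C.U),
          IsHom D A s → IsHom D C t → s.comp f = t.comp g →
            ∃ r : Univ.Hom D.U P.U, IsHom D P r ∧ r.comp p₁ = s ∧ r.comp p₂ = t := by
  obtain ⟨PU, p₁, p₂, hp, hP⟩ := Univ.exists_isPullback f g
  let P : CodedUniv K :=
    { U := PU
      codes :=
        { pi := fun x => hP.lift (A.codes.pi (p₁.fam x)) (C.codes.pi (p₂.fam x))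
            (by rw [hf.strict.pi, hg.strict.pi, ← Univ.Hom.fam_comp, ← Univ.Hom.fam_comp, hp])
          sigma := fun x => hP.lift (A.codes.sigma (p₁.fam x)) (C.codes.sigma (p₂.fam x))
            (by rw [hf.strict.sigma, hg.strict.sigma, ← Univ.Hom.fam_comp, ← Univ.Hom.fam_comp,
              hp])
          eq := fun x => hP.lift (A.codes.eq (p₁.pair x)) (C.codes.eq (p₂.pair x))
            (by rw [hf.strict.eq, hg.strict.eq, ← Univ.Hom.pair_comp, ← Univ.Hom.pair_comp, hp])
          unit := hP.lift A.codes.unit C.codes.unit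
            (by rw [hf.strict.unit, hg.strict.unit])
          bool := hP.lift A.codes.bool C.codes.bool
            (by rw [hf.strict.bool, hg.strict.bool])
          pi_subst := fun τ x => by
            apply hP.hom_ext
            · rw [Category.assoc, hP.lift_fst, hP.lift_fst, A.codes.pi_subst,
                Univ.Hom.fam_subst]
            · rw [Category.assoc, hP.lift_snd, hP.lift_snd, C.codes.pi_subst,
                Univ.Hom.fam_subst]
          sigma_subst := fun τ x => by
            apply hP.hom_ext
            · rw [Category.assoc, hP.lift_fst, hP.lift_fst, A.codes.sigma_subst,
                Univ.Hom.fam_subst]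
            · rw [Category.assoc, hP.lift_snd, hP.lift_snd, C.codes.sigma_subst,
                Univ.Hom.fam_subst]
          eq_subst := fun τ x => by
            apply hP.hom_ext
            · rw [Category.assoc, hP.lift_fst, hP.lift_fst, A.codes.eq_subst,
                Univ.Hom.pair_subst]
            · rw [Category.assoc, hP.lift_snd, hP.lift_snd, C.codes.eq_subst,
                Univ.Hom.pair_subst] }
      const := fun j => hP.lift (A.const j) (C.const j) (by rw [hf.const, hg.const]) }
  refine ⟨P, p₁, p₂, ⟨⟨fun x => ?_, fun x => ?_, fun x => ?_, ?_, ?_⟩, fun j => ?_⟩,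
    ⟨⟨fun x => ?_, fun x => ?_, fun x => ?_, ?_, ?_⟩, fun j => ?_⟩, hp, ?_⟩
  any_goals exact hP.lift_fst _ _ _
  any_goals exact hP.lift_snd _ _ _
  intro D s t hs ht e
  let r : Univ.Hom D.U P.U := s.ofTy p₁
    (hP.lift s.ty t.ty (congrArg Univ.Hom.ty e)) (hP.lift_fst _ _ _)
  have hr₁ : r.comp p₁ = s := Univ.Hom.ofTy_comp _ _ _ _
  have hr₂ : r.comp p₂ = t := by
    apply Univ.Hom.ext_of_comp g
    · rw [Univ.Hom.comp_assoc, ← hp, ← Univ.Hom.comp_assoc, hr₁, e]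
    · exact hP.lift_snd _ _ _
  refine ⟨r, ⟨⟨fun x => ?_, fun x => ?_, fun x => ?_, ?_, ?_⟩, fun j => ?_⟩, hr₁, hr₂⟩
  · apply hP.hom_ext
    · refine (Category.assoc _ _ _).trans (Eq.trans ?_ (hP.lift_fst _ _ _).symm)
      rw [← Univ.Hom.fam_comp, hr₁, ← hs.strict.pi]
      exact congrArg _ (hP.lift_fst _ _ _)
    · refine (Category.assoc _ _ _).trans (Eq.trans ?_ (hP.lift_snd _ _ _).symm)
      rw [← Univ.Hom.fam_comp, hr₂, ← ht.strict.pi]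
      exact congrArg _ (hP.lift_snd _ _ _)
  · apply hP.hom_ext
    · refine (Category.assoc _ _ _).trans (Eq.trans ?_ (hP.lift_fst _ _ _).symm)
      rw [← Univ.Hom.fam_comp, hr₁, ← hs.strict.sigma]
      exact congrArg _ (hP.lift_fst _ _ _)
    · refine (Category.assoc _ _ _).trans (Eq.trans ?_ (hP.lift_snd _ _ _).symm)
      rw [← Univ.Hom.fam_comp, hr₂, ← ht.strict.sigma]
      exact congrArg _ (hP.lift_snd _ _ _)
  · apply hP.hom_ext
    · refine (Category.assoc _ _ _).trans (Eq.trans ?_ (hP.lift_fst _ _ _).symm)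
      rw [← Univ.Hom.pair_comp, hr₁, ← hs.strict.eq]
      exact congrArg _ (hP.lift_fst _ _ _)
    · refine (Category.assoc _ _ _).trans (Eq.trans ?_ (hP.lift_snd _ _ _).symm)
      rw [← Univ.Hom.pair_comp, hr₂, ← ht.strict.eq]
      exact congrArg _ (hP.lift_snd _ _ _)
  · apply hP.hom_ext
    · refine (Category.assoc _ _ _).trans (Eq.trans ?_ (hP.lift_fst _ _ _).symm)
      rw [← hs.strict.unit]
      exact congrArg _ (hP.lift_fst _ _ _)
    · refine (Category.assoc _ _ _).trans (Eq.trans ?_ (hP.lift_snd _ _ _).symm)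
      rw [← ht.strict.unit]
      exact congrArg _ (hP.lift_snd _ _ _)
  · apply hP.hom_ext
    · refine (Category.assoc _ _ _).trans (Eq.trans ?_ (hP.lift_fst _ _ _).symm)
      rw [← hs.strict.bool]
      exact congrArg _ (hP.lift_fst _ _ _)
    · refine (Category.assoc _ _ _).trans (Eq.trans ?_ (hP.lift_snd _ _ _).symm)
      rw [← ht.strict.bool]
      exact congrArg _ (hP.lift_snd _ _ _)
  · apply hP.hom_ext
    · refine (Category.assoc _ _ _).trans (Eq.trans ?_ (hP.lift_fst _ _ _).symm)
      rw [← hs.const]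
      exact congrArg _ (hP.lift_fst _ _ _)
    · refine (Category.assoc _ _ _).trans (Eq.trans ?_ (hP.lift_snd _ _ _).symm)
      rw [← ht.const]
      exact congrArg _ (hP.lift_snd _ _ _)

/-- Initiality over one universe implies initiality over any other one. -/
theorem IsInitialOver.change_base {A B B' : CodedUniv K} {h : Univ.Hom A.U B.U}
    (hA : IsInitialOver A B h) {h' : Univ.Hom A.U B'.U} (hh' : IsHom A B' h') :
    IsInitialOver A B' h' where
  isHom := hh'
  exists_hom C k hk := by
    -- Maps from `A` to `C` over `B'` amount to sections of the pullback of `C` to `A`. Existence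
    -- and uniqueness of sections follow from initiality over `B`.
    obtain ⟨P, p₁, p₂, hp₁, hp₂, hp, -⟩ := exists_pullback hh' hk
    obtain ⟨s, hs, e⟩ := hA.exists_section hp₁
    refine ⟨s.comp p₂, hs.comp hp₂, ?_⟩
    rw [Univ.Hom.comp_assoc, ← hp, ← Univ.Hom.comp_assoc, e, Univ.Hom.id_comp]
  hom_ext C k hk f g hf hg ef eg := by
    obtain ⟨P, p₁, p₂, hp₁, hp₂, hp, huniv⟩ := exists_pullback hh' hk
    obtain ⟨r, hr, hr₁, hr₂⟩ := huniv A (Univ.Hom.id _) f (IsHom.id A) hf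
      (by rw [ef, Univ.Hom.id_comp])
    obtain ⟨r', hr', hr₁', hr₂'⟩ := huniv A (Univ.Hom.id _) g (IsHom.id A) hg
      (by rw [eg, Univ.Hom.id_comp])
    have : r = r' := hA.hom_ext P (p₁.comp h) (hp₁.comp hA.isHom) r r' hr hr'
      (by rw [← Univ.Hom.comp_assoc, hr₁, Univ.Hom.id_comp])
      (by rw [← Univ.Hom.comp_assoc, hr₁', Univ.Hom.id_comp])
    rw [← hr₂, ← hr₂', this]

theorem IsInitialOver.nonempty_iso {A A' B : CodedUniv K} {h : Univ.Hom A.U B.U}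
    {h' : Univ.Hom A'.U B.U} (hA : IsInitialOver A B h) (hA' : IsInitialOver A' B h') :
    Nonempty (A.U.Ty ≅ A'.U.Ty) := by
  obtain ⟨f, hf, ef⟩ := hA.exists_hom A' h' hA'.isHom
  obtain ⟨g, hg, eg⟩ := hA'.exists_hom A h hA.isHom
  have e₁ := hA.hom_ext A h hA.isHom _ _ (hf.comp hg) (IsHom.id A)
    (by rw [Univ.Hom.comp_assoc, eg, ef]) (Univ.Hom.id_comp h)
  have e₂ := hA'.hom_ext A' h' hA'.isHom _ _ (hg.comp hf) (IsHom.id A')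
    (by rw [Univ.Hom.comp_assoc, ef, eg]) (Univ.Hom.id_comp h')
  exact ⟨⟨f.ty, g.ty, congrArg Univ.Hom.ty e₁, congrArg Univ.Hom.ty e₂⟩⟩

/-- Codes on a universe `W` over `U`, named by a section of the map of codes. -/
noncomputable def _root_.TarskiUniverse.Univ.Codes.ofSection {U W : Univ E} (c : U.Codes)
    (r : Univ.Hom W U) (t : U.Ty ⟶ W.Ty) : W.Codes where
  pi x := c.pi (r.fam x) ≫ t
  sigma x := c.sigma (r.fam x) ≫ t
  eq x := c.eq (r.pair x) ≫ t
  unit := c.unit ≫ t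
  bool := c.bool ≫ t
  pi_subst τ x := by rw [← Category.assoc, c.pi_subst, Univ.Hom.fam_subst]
  sigma_subst τ x := by rw [← Category.assoc, c.sigma_subst, Univ.Hom.fam_subst]
  eq_subst τ x := by rw [← Category.assoc, c.eq_subst, Univ.Hom.pair_subst]

theorem _root_.TarskiUniverse.Univ.Codes.ofSection_isStrict {U W : Univ E} (c : U.Codes)
    (r : Univ.Hom W U) (t : U.Ty ⟶ W.Ty) (ht : t ≫ r.ty = 𝟙 _) :
    r.IsStrict (c.ofSection r t) c where
  pi x := by simp [Univ.Codes.ofSection, ht]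
  sigma x := by simp [Univ.Codes.ofSection, ht]
  eq x := by simp [Univ.Codes.ofSection, ht]
  unit := by simp [Univ.Codes.ofSection, ht]
  bool := by simp [Univ.Codes.ofSection, ht]

variable [HasFiniteCoproducts E] [LCCC E]

/-- The new object of codes is `P ⨿ U.Ty`: each type `d x` acquires a second name `inl x`, and
distinct `x` have distinct names. -/
theorem _root_.TarskiUniverse.Univ.exists_adjoin (U : Univ E) {P : E} (d : P ⟶ U.Ty) :
    ∃ (W : Univ E) (r : Univ.Hom W U) (i : P ⟶ W.Ty) (t : U.Ty ⟶ W.Ty), Mono i ∧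
      i ≫ r.ty = d ∧ t ≫ r.ty = 𝟙 _ :=
  ⟨U.restrict (coprod.desc d (𝟙 U.Ty)), U.restrictHom _, coprod.inl, coprod.inr,
    mono_coprod_inl P U.Ty, coprod.inl_desc _ _, coprod.inr_desc _ _⟩

/-- The codes of an initial universe are injective. -/
theorem IsInitialOver.isInjective {A B : CodedUniv K} {h : Univ.Hom A.U B.U}
    (hA : IsInitialOver A B h) : A.codes.IsInjective where
  pi Γ x y hxy := by
    obtain ⟨P, G, name, h₁, h₂⟩ := Univ.exists_genericFam A.U
    have hn : ∀ {Γ Δ : E} (τ : Δ ⟶ Γ) (x : A.U.Fam Γ), τ ≫ name x = name (x.subst τ) :=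
      fun τ x => by rw [← h₂ (τ ≫ name x), ← Univ.Fam.subst_subst, h₁]
    obtain ⟨W, r, i, t, hi, hir, htr⟩ := A.U.exists_adjoin (A.codes.pi G)
    have hc := A.codes.ofSection_isStrict r t htr
    -- In `C`, a product is named by the family it is formed from, through `i`; all other codes use
    -- the old names.
    let C : CodedUniv K :=
      { U := W
        codes :=
          { A.codes.ofSection r t with
            pi := fun x => name (r.fam x) ≫ i
            pi_subst := fun τ x => by rw [← Category.assoc, hn, Univ.Hom.fam_subst] }
        const := fun j => A.const j ≫ t }
    have hr : IsHom C A r :=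
      { strict :=
          { hc with
            pi := fun x => by rw [Category.assoc, hir, A.codes.pi_subst, h₁] }
        const := fun j => by rw [Category.assoc, htr, Category.comp_id] }
    obtain ⟨s, hs, e⟩ := hA.exists_section hr
    -- The section `s` reads off the family `z` from the code `pi z`.
    have key : ∀ z : A.U.Fam Γ, A.codes.pi z ≫ s.ty = name z ≫ i :=
      fun z => (hs.strict.pi z).trans (by
        change name (r.fam (s.fam z)) ≫ i = _
        rw [← Univ.Hom.fam_comp, e, Univ.Hom.fam_id])
    have : name x = name y := (cancel_mono i).1
      ((key x).symm.trans ((congrArg (· ≫ s.ty) hxy).trans (key y)))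
    rw [← h₁ x, this, h₁]
  sigma Γ x y hxy := by
    obtain ⟨P, G, name, h₁, h₂⟩ := Univ.exists_genericFam A.U
    have hn : ∀ {Γ Δ : E} (τ : Δ ⟶ Γ) (x : A.U.Fam Γ), τ ≫ name x = name (x.subst τ) :=
      fun τ x => by rw [← h₂ (τ ≫ name x), ← Univ.Fam.subst_subst, h₁]
    obtain ⟨W, r, i, t, hi, hir, htr⟩ := A.U.exists_adjoin (A.codes.sigma G)
    have hc := A.codes.ofSection_isStrict r t htr
    let C : CodedUniv K :=
      { U := W
        codes :=
          { A.codes.ofSection r t with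
            sigma := fun x => name (r.fam x) ≫ i
            sigma_subst := fun τ x => by rw [← Category.assoc, hn, Univ.Hom.fam_subst] }
        const := fun j => A.const j ≫ t }
    have hr : IsHom C A r :=
      { strict :=
          { hc with
            sigma := fun x => by rw [Category.assoc, hir, A.codes.sigma_subst, h₁] }
        const := fun j => by rw [Category.assoc, htr, Category.comp_id] }
    obtain ⟨s, hs, e⟩ := hA.exists_section hr
    have key : ∀ z : A.U.Fam Γ, A.codes.sigma z ≫ s.ty = name z ≫ i :=
      fun z => (hs.strict.sigma z).trans (by
        change name (r.fam (s.fam z)) ≫ i = _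
        rw [← Univ.Hom.fam_comp, e, Univ.Hom.fam_id])
    have : name x = name y := (cancel_mono i).1
      ((key x).symm.trans ((congrArg (· ≫ s.ty) hxy).trans (key y)))
    rw [← h₁ x, this, h₁]
  eq Γ x y hxy := by
    obtain ⟨P, G, name, h₁, h₂⟩ := Univ.exists_genericPair A.U
    have hn : ∀ {Γ Δ : E} (τ : Δ ⟶ Γ) (x : A.U.Pair Γ), τ ≫ name x = name (x.subst τ) :=
      fun τ x => by rw [← h₂ (τ ≫ name x), ← Univ.Pair.subst_subst, h₁]
    obtain ⟨W, r, i, t, hi, hir, htr⟩ := A.U.exists_adjoin (A.codes.eq G)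
    have hc := A.codes.ofSection_isStrict r t htr
    let C : CodedUniv K :=
      { U := W
        codes :=
          { A.codes.ofSection r t with
            eq := fun x => name (r.pair x) ≫ i
            eq_subst := fun τ x => by rw [← Category.assoc, hn, Univ.Hom.pair_subst] }
        const := fun j => A.const j ≫ t }
    have hr : IsHom C A r :=
      { strict :=
          { hc with
            eq := fun x => by rw [Category.assoc, hir, A.codes.eq_subst, h₁] }
        const := fun j => by rw [Category.assoc, htr, Category.comp_id] }
    obtain ⟨s, hs, e⟩ := hA.exists_section hr
    have key : ∀ z : A.U.Pair Γ, A.codes.eq z ≫ s.ty = name z ≫ i :=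
      fun z => (hs.strict.eq z).trans (by
        change name (r.pair (s.pair z)) ≫ i = _
        rw [← Univ.Hom.pair_comp, e, Univ.Hom.pair_id])
    have : name x = name y := (cancel_mono i).1
      ((key x).symm.trans ((congrArg (· ≫ s.ty) hxy).trans (key y)))
    rw [← h₁ x, this, h₁]

end CodedUniv

end CodedUniverses

end TarskiUniverse

namespace TarskiUniverse

/-! ### The universe of isomorphisms between types of two universes -/

section IsomorphismContexts

variable {E : Type u} [Category.{v} E] [HasFiniteLimits E]

namespace Univ

variable {U V W : Univ E}

theorem extMap_hom_ext {Γ Δ Z : E} {τ : Δ ⟶ Γ} {a : Γ ⟶ U.Ty} {b : Δ ⟶ U.Ty} (h : b = τ ≫ a)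
    {f g : Z ⟶ U.ext b} (h₁ : f ≫ U.proj b = g ≫ U.proj b)
    (h₂ : f ≫ U.extMap τ h = g ≫ U.extMap τ h) : f = g :=
  (isPullback_extMap τ h).hom_ext h₂ h₁

theorem exists_reindex {Γ Δ : E} {a : Γ ⟶ U.Ty} {b : Γ ⟶ W.Ty} (f : U.ext a ⟶ W.ext b)
    (hf : f ≫ W.proj b = U.proj a) (γ : Δ ⟶ Γ) {a' : Δ ⟶ U.Ty} {b' : Δ ⟶ W.Ty}
    (ha : a' = γ ≫ a) (hb : b' = γ ≫ b) :
    ∃ f' : U.ext a' ⟶ W.ext b', f' ≫ W.proj b' = U.proj a' ∧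
      f' ≫ W.extMap γ hb = U.extMap γ ha ≫ f :=
  ⟨(isPullback_extMap γ hb).lift (U.extMap γ ha ≫ f) (U.proj a')
    (by rw [Category.assoc, hf, extMap_fst]), IsPullback.lift_snd _ _ _ _,
    IsPullback.lift_fst _ _ _ _⟩

variable [LCCC E]

/-- The context `Γ, f : El a → El b`. -/
theorem exists_homCtx {Γ : E} (a : Γ ⟶ U.Ty) (b : Γ ⟶ W.Ty) :
    ∃ (P : E) (π : P ⟶ Γ) (f : U.ext (π ≫ a) ⟶ W.ext (π ≫ b)),
      f ≫ W.proj (π ≫ b) = U.proj (π ≫ a) ∧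
        ∀ {Δ : E} (γ : Δ ⟶ Γ) {a' : Δ ⟶ U.Ty} {b' : Δ ⟶ W.Ty} (_ : a' = γ ≫ a) (_ : b' = γ ≫ b)
          (g : U.ext a' ⟶ W.ext b'), g ≫ W.proj b' = U.proj a' →
            ∃ (δ : Δ ⟶ P) (_ : δ ≫ π = γ) (ha : a' = δ ≫ π ≫ a) (hb : b' = δ ≫ π ≫ b),
              g ≫ W.extMap δ hb = U.extMap δ ha ≫ f := by
  -- A function `El a → El b` over `Γ` is a section of the pullback of `El b` to the context `Γ, x :
  -- El a`.
  obtain ⟨P, π, ev, hev, huniv⟩ := exists_piCtx a (pullback.fst (U.proj a) (W.proj b))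
  have hw : (ev ≫ pullback.snd (U.proj a) (W.proj b)) ≫ W.proj b = U.proj (π ≫ a) ≫ π := by
    rw [Category.assoc, ← pullback.condition, reassoc_of% hev, extMap_fst]
  refine ⟨P, π, (isPullback_extMap π rfl).lift (ev ≫ pullback.snd _ _) (U.proj _) hw,
    IsPullback.lift_snd _ _ _ _, ?_⟩
  rintro Δ γ a' b' rfl rfl g hg
  obtain ⟨δ, ⟨h, hδ⟩, -⟩ := huniv γ (pullback.lift (U.extMap γ rfl) (g ≫ W.extMap γ rfl)
    (by rw [Category.assoc, extMap_fst, extMap_fst, reassoc_of% hg])) (pullback.lift_fst _ _ _)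
  have ha : γ ≫ a = δ ≫ π ≫ a := by rw [← h, Category.assoc]
  have hb : γ ≫ b = δ ≫ π ≫ b := by rw [← h, Category.assoc]
  refine ⟨δ, h, ha, hb, ?_⟩
  apply extMap_hom_ext (τ := π) rfl
  · rw [Category.assoc g, extMap_fst, reassoc_of% hg, Category.assoc (U.extMap δ ha),
      IsPullback.lift_snd, extMap_fst]
  · rw [Category.assoc g, extMap_trans, Category.assoc (U.extMap δ ha), IsPullback.lift_fst,
      ← Category.assoc (U.extMap δ ha), hδ, pullback.lift_snd]
    congr 1
    exact extMap_congr h _ _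

/-- The context `Γ, ∀ x : El a. u x = v x`. -/
theorem exists_forallCtx {Γ Y : E} (a : Γ ⟶ U.Ty) (u v : U.ext a ⟶ Y) :
    ∃ (P : E) (π : P ⟶ Γ), U.extMap π rfl ≫ u = U.extMap π rfl ≫ v ∧
      ∀ {Δ : E} (γ : Δ ⟶ Γ) {a' : Δ ⟶ U.Ty} (ha : a' = γ ≫ a),
        U.extMap γ ha ≫ u = U.extMap γ ha ≫ v → ∃ δ : Δ ⟶ P, δ ≫ π = γ := by
  obtain ⟨P, π, ev, hev, huniv⟩ := exists_piCtx a (equalizer.ι u v)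
  refine ⟨P, π, ?_, ?_⟩
  · rw [← hev, Category.assoc, equalizer.condition, Category.assoc]
  · rintro Δ γ a' rfl h
    obtain ⟨δ, ⟨hδ, -⟩, -⟩ := huniv γ (equalizer.lift _ h) (equalizer.lift_ι _ _)
    exact ⟨δ, hδ⟩

/-- There is a universe that classifies isomorphisms between types of `U` and types of `W`. -/
theorem exists_isoUniv (U W : Univ E) :
    ∃ (B : Univ E) (h₁ : Hom B U) (h₂ : Hom B W),
      ∀ {Δ : E} (a : Δ ⟶ U.Ty) (b : Δ ⟶ W.Ty), W.Decodes b (U.proj a) →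
        ∃ y : Δ ⟶ B.Ty, y ≫ h₁.ty = a ∧ y ≫ h₂.ty = b := by
  -- The classifying context is a tower over pairs of codes: `P₁` adds a map `f`, `P₂` a map `g`
  -- backwards, `P₃` the equation `g (f x) = x`, and `P₄` the equation `f (g y) = y`.
  obtain ⟨P₁, π₁, f₁, hf₁, huniv₁⟩ :=
    exists_homCtx (prod.fst : U.Ty ⨯ W.Ty ⟶ U.Ty) (prod.snd : U.Ty ⨯ W.Ty ⟶ W.Ty)
  obtain ⟨P₂, π₂, g₂, hg₂, huniv₂⟩ := exists_homCtx (π₁ ≫ prod.snd) (π₁ ≫ prod.fst)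
  obtain ⟨f₂, hf₂, hf₂'⟩ := exists_reindex f₁ hf₁ π₂ rfl rfl
  obtain ⟨P₃, π₃, h₃, huniv₃⟩ := exists_forallCtx (π₂ ≫ π₁ ≫ prod.fst) (f₂ ≫ g₂) (𝟙 _)
  obtain ⟨P₄, π₄, h₄, huniv₄⟩ := exists_forallCtx (π₃ ≫ π₂ ≫ π₁ ≫ prod.snd)
    (W.extMap π₃ rfl ≫ g₂ ≫ f₂) (W.extMap π₃ rfl)
  have ha : π₄ ≫ π₃ ≫ π₂ ≫ π₁ ≫ prod.fst = (π₄ ≫ π₃) ≫ π₂ ≫ π₁ ≫ prod.fst := by simp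
  have hb : π₄ ≫ π₃ ≫ π₂ ≫ π₁ ≫ prod.snd = (π₄ ≫ π₃) ≫ π₂ ≫ π₁ ≫ prod.snd := by simp
  obtain ⟨f, hf, hf'⟩ := exists_reindex f₂ hf₂ (π₄ ≫ π₃) ha hb
  obtain ⟨g, hg, hg'⟩ := exists_reindex g₂ hg₂ (π₄ ≫ π₃) hb ha
  rw [Category.comp_id] at h₃
  rw [extMap_trans_assoc, extMap_trans] at h₄
  have hfg : f ≫ g = 𝟙 _ := by
    apply extMap_hom_ext ha
    · rw [Category.assoc f, hg, hf, Category.id_comp]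
    · rw [Category.assoc f, hg', reassoc_of% hf', Category.id_comp]
      have := congrArg (U.extMap π₄ (a := π₃ ≫ π₂ ≫ π₁ ≫ prod.fst) rfl ≫ ·) h₃
      rw [extMap_trans_assoc, extMap_trans] at this
      exact this
  have hgf : g ≫ f = 𝟙 _ := by
    apply extMap_hom_ext hb
    · rw [Category.assoc g, hf, hg, Category.id_comp]
    · rw [Category.assoc g, hf', reassoc_of% hg', Category.id_comp]
      exact h₄
  -- The generic isomorphism exhibits the decoded family of `U` as a pullback of `W.p`; this is the
  -- cartesian square of `h₂`.
  obtain ⟨t, ht⟩ := (decodes_proj (U := W) (π₄ ≫ π₃ ≫ π₂ ≫ π₁ ≫ prod.snd)).of_iso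
    ⟨f, g, hfg, hgf⟩ hf
  refine ⟨U.restrict (π₄ ≫ π₃ ≫ π₂ ≫ π₁ ≫ prod.fst), U.restrictHom _,
    ⟨π₄ ≫ π₃ ≫ π₂ ≫ π₁ ≫ prod.snd, t, ht⟩, ?_⟩
  intro Δ a b hab
  obtain ⟨e, he⟩ := (decodes_proj b).exists_iso hab
  have he' : e.inv ≫ U.proj a = W.proj b := by rw [← he, Iso.inv_hom_id_assoc]
  obtain ⟨δ₁, hδ₁, ha₁, hb₁, sq₁⟩ := huniv₁ (prod.lift a b) (prod.lift_fst _ _).symm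
    (prod.lift_snd _ _).symm e.hom he
  obtain ⟨δ₂, hδ₂, hb₂, ha₂, sq₂⟩ := huniv₂ δ₁ hb₁ ha₁ e.inv he'
  have sq₁' : e.hom ≫ W.extMap δ₂ hb₂ = U.extMap δ₂ ha₂ ≫ f₂ := by
    apply extMap_hom_ext (τ := π₂) rfl
    · rw [Category.assoc e.hom, extMap_fst, reassoc_of% he, Category.assoc (U.extMap δ₂ ha₂), hf₂,
        extMap_fst]
    · rw [Category.assoc e.hom, extMap_trans, Category.assoc (U.extMap δ₂ ha₂), hf₂',
        extMap_trans_assoc, extMap_congr hδ₂ _ hb₁, extMap_congr hδ₂ _ ha₁, sq₁]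
  obtain ⟨δ₃, hδ₃⟩ := huniv₃ δ₂ ha₂ (by
    rw [← reassoc_of% sq₁', ← sq₂, Iso.hom_inv_id_assoc, Category.comp_id])
  have hb₃ : b = δ₃ ≫ π₃ ≫ π₂ ≫ π₁ ≫ prod.snd := by rw [reassoc_of% hδ₃, hb₂]
  obtain ⟨δ₄, hδ₄⟩ := huniv₄ δ₃ hb₃ (by
    rw [extMap_trans_assoc, extMap_trans, extMap_congr hδ₃ _ hb₂, ← reassoc_of% sq₂, ← sq₁',
      Iso.inv_hom_id_assoc])
  refine ⟨δ₄, ?_, ?_⟩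
  · change δ₄ ≫ π₄ ≫ π₃ ≫ π₂ ≫ π₁ ≫ prod.fst = a
    rw [reassoc_of% hδ₄, reassoc_of% hδ₃, ← ha₂]
  · change δ₄ ≫ π₄ ≫ π₃ ≫ π₂ ≫ π₁ ≫ prod.snd = b
    rw [reassoc_of% hδ₄, reassoc_of% hδ₃, ← hb₂]

end Univ

end IsomorphismContexts

/-! ### Weak codes decode alike along maps of universes -/

section DecodedTypes

variable {E : Type u} [Category.{v} E] [HasFiniteLimits E]

namespace Univ

variable {U V : Univ E}

/-- Under a map of universes, a family of codes and its image decode to isomorphic families. -/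
theorem Hom.exists_iso_ext_fam (h : Hom V U) {Γ : E} (x : V.Fam Γ) :
    ∃ q : U.ext (h.fam x).cod ≅ V.ext x.cod,
      q.hom ≫ V.proj x.cod =
        U.proj (h.fam x).cod ≫ (h.extIso (a := x.dom) (b := (h.fam x).dom) rfl).hom := by
  let i := h.extIso (a := x.dom) (b := (h.fam x).dom) rfl
  have e : (h.fam x).cod = (i.hom ≫ x.cod) ≫ h.ty := (Category.assoc _ _ _).symm
  have hp := isPullback_extMap (U := V) (a := x.cod) i.hom rfl
  have := hp.isIso_fst_of_isIso
  refine ⟨h.extIso e ≪≫ asIso (V.extMap (a := x.cod) i.hom rfl), ?_⟩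
  rw [Iso.trans_hom, asIso_hom, Category.assoc, extMap_fst, extIso_hom_fst_assoc]

end Univ

variable [LCCC E]

/-- Dependent products are invariant under isomorphism. -/
theorem nonempty_pi_iso {Γ Y Y' Z Z' : E} (f : Y ⟶ Γ) (f' : Y' ⟶ Γ) (z : Z ⟶ Y) (z' : Z' ⟶ Y')
    (e : Y ≅ Y') (he : e.hom ≫ f' = f) (q : Z ≅ Z') (hq : q.hom ≫ z' = z ≫ e.hom) :
    Nonempty ((Over.pullback f).rightAdjoint.obj (Over.mk z) ≅
      (Over.pullback f').rightAdjoint.obj (Over.mk z')) := by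
  subst he
  -- For an isomorphism `e`, pulling back is also left adjoint to `Over.map e.hom`. Composing
  -- adjunctions and using uniqueness of right adjoints, the product along `e.hom ≫ f'` is `Over.map
  -- e.hom` followed by the product along `f'`.
  let adjE : Over.pullback e.hom ⊣ Over.map e.hom :=
    (Over.mapIso e).symm.toAdjunction.ofNatIsoLeft
      (Adjunction.rightAdjointUniq (Over.mapIso e).toAdjunction (Over.mapPullbackAdj e.hom))
  let adj := ((Adjunction.ofIsLeftAdjoint (Over.pullback f')).comp adjE).ofNatIsoLeft
    (Over.pullbackComp e.hom f').symm
  let i := Adjunction.rightAdjointUniq (Adjunction.ofIsLeftAdjoint (Over.pullback (e.hom ≫ f'))) adj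
  exact ⟨i.app (Over.mk z) ≪≫ (Over.pullback f').rightAdjoint.mapIso
    (Over.isoMk q hq : Over.mk (z ≫ e.hom) ≅ Over.mk z')⟩

namespace Univ

variable [HasFiniteCoproducts E] {U V : Univ E}

/-- The right-hand side does not mention `U`. Two weak universes under `V` can therefore be compared
through the product formed in `V`. -/
theorem Codes.IsWeak.decodes_pi_fam {c : U.Codes} (hc : c.IsWeak) (h : Hom V U) {Γ : E}
    (x : V.Fam Γ) :
    U.Decodes (c.pi (h.fam x))
      ((Over.pullback (V.proj x.dom)).rightAdjoint.obj (Over.mk (V.proj x.cod))).hom := by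
  obtain ⟨q, hq⟩ := h.exists_iso_ext_fam x
  obtain ⟨i⟩ := nonempty_pi_iso (U.proj (h.fam x).dom) (V.proj x.dom) (U.proj (h.fam x).cod)
    (V.proj x.cod) (h.extIso (b := (h.fam x).dom) rfl) (h.extIso_hom_fst rfl) q hq
  exact (hc.pi (h.fam x)).of_iso ((Over.forget Γ).mapIso i.symm) (Over.w i.inv)

theorem Codes.IsWeak.decodes_sigma_fam {c : U.Codes} (hc : c.IsWeak) (h : Hom V U) {Γ : E}
    (x : V.Fam Γ) : U.Decodes (c.sigma (h.fam x)) (V.proj x.cod ≫ V.proj x.dom) := by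
  obtain ⟨q, hq⟩ := h.exists_iso_ext_fam x
  refine (hc.sigma (h.fam x)).of_iso q.symm ?_
  rw [Iso.symm_hom, Iso.inv_comp_eq, ← Category.assoc, hq, Category.assoc]
  congr 1
  exact (h.extIso_hom_fst rfl).symm

theorem Codes.IsWeak.decodes_eq_pair {c : U.Codes} (hc : c.IsWeak) (h : Hom V U) {Γ : E}
    (x : V.Pair Γ) : U.Decodes (c.eq (h.pair x)) (equalizer.ι x.lhs x.rhs) := by
  have w₁ : equalizer.ι x.lhs x.rhs ≫ (h.pair x).lhs = equalizer.ι x.lhs x.rhs ≫ (h.pair x).rhs :=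
    equalizer.condition_assoc _ _ _
  have w₂ : equalizer.ι (h.pair x).lhs (h.pair x).rhs ≫ x.lhs =
      equalizer.ι (h.pair x).lhs (h.pair x).rhs ≫ x.rhs := by
    apply h.isPullback.hom_ext
    · rw [Category.assoc, Category.assoc]
      exact equalizer.condition (h.pair x).lhs (h.pair x).rhs
    · rw [Category.assoc, Category.assoc, x.eq]
  refine (hc.eq (h.pair x)).of_iso ⟨equalizer.lift _ w₁, equalizer.lift _ w₂, ?_, ?_⟩
    (equalizer.lift_ι _ _)
  · apply equalizer.hom_ext
    rw [Category.assoc, equalizer.lift_ι, equalizer.lift_ι, Category.id_comp]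
  · apply equalizer.hom_ext
    rw [Category.assoc, equalizer.lift_ι, equalizer.lift_ι, Category.id_comp]

end Univ

/-- Two weak universes whose constants decode to isomorphic families are related by a span of
maps that strictly preserve all codes. -/
theorem CodedUniv.exists_span [HasFiniteCoproducts E] {J : Type} {K : J → E} (A A' : CodedUniv K)
    (hA : A.codes.IsWeak) (hA' : A'.codes.IsWeak)
    (hc : ∀ j, A'.U.Decodes (A'.const j) (A.U.proj (A.const j))) :
    ∃ (B : CodedUniv K) (f : Univ.Hom B.U A.U) (g : Univ.Hom B.U A'.U),
      IsHom B A f ∧ IsHom B A' g := by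
  -- The codes that `A` and `A'` assign to the two images of a family of `B` decode to the same
  -- type, so `B` has a name for this pair of codes; `exists_famOp` and `exists_pairOp` choose the
  -- names stably under substitution.
  obtain ⟨B, f, g, huniv⟩ := Univ.exists_isoUniv A.U A'.U
  obtain ⟨pi, pi_subst, hpi⟩ := B.exists_famOp
    (fun x y => y ≫ f.ty = A.codes.pi (f.fam x) ∧ y ≫ g.ty = A'.codes.pi (g.fam x))
    (fun τ x y hy => by
      rw [Category.assoc, Category.assoc, hy.1, hy.2, A.codes.pi_subst, A'.codes.pi_subst,
        Univ.Hom.fam_subst, Univ.Hom.fam_subst]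
      exact ⟨rfl, rfl⟩)
    (fun x => huniv _ _ ((hA.decodes_pi_fam f x).proj (hA'.decodes_pi_fam g x)))
  obtain ⟨sigma, sigma_subst, hsigma⟩ := B.exists_famOp
    (fun x y => y ≫ f.ty = A.codes.sigma (f.fam x) ∧ y ≫ g.ty = A'.codes.sigma (g.fam x))
    (fun τ x y hy => by
      rw [Category.assoc, Category.assoc, hy.1, hy.2, A.codes.sigma_subst, A'.codes.sigma_subst,
        Univ.Hom.fam_subst, Univ.Hom.fam_subst]
      exact ⟨rfl, rfl⟩)
    (fun x => huniv _ _ ((hA.decodes_sigma_fam f x).proj (hA'.decodes_sigma_fam g x)))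
  obtain ⟨eq, eq_subst, heq⟩ := B.exists_pairOp
    (fun x y => y ≫ f.ty = A.codes.eq (f.pair x) ∧ y ≫ g.ty = A'.codes.eq (g.pair x))
    (fun τ x y hy => by
      rw [Category.assoc, Category.assoc, hy.1, hy.2, A.codes.eq_subst, A'.codes.eq_subst,
        Univ.Hom.pair_subst, Univ.Hom.pair_subst]
      exact ⟨rfl, rfl⟩)
    (fun x => huniv _ _ ((hA.decodes_eq_pair f x).proj (hA'.decodes_eq_pair g x)))
  obtain ⟨unit, hunit⟩ := huniv _ _ (hA.unit.proj hA'.unit)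
  obtain ⟨bool, hbool⟩ := huniv _ _ (hA.bool.proj hA'.bool)
  choose const hconst using fun j => huniv _ _ (hc j)
  exact ⟨⟨B, ⟨pi, sigma, eq, unit, bool, pi_subst, sigma_subst, eq_subst⟩, const⟩, f, g,
    ⟨⟨fun x => (hpi x).1, fun x => (hsigma x).1, fun x => (heq x).1, hunit.1, hbool.1⟩,
      fun j => (hconst j).1⟩,
    ⟨⟨fun x => (hpi x).2, fun x => (hsigma x).2, fun x => (heq x).2, hunit.2, hbool.2⟩,
      fun j => (hconst j).2⟩⟩

end DecodedTypes

end TarskiUniverse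

namespace TarskiUniverse

/-! ### Induction-recursion with constructors indexed by a finite type -/

section IndexedInductionRecursion

variable {E : Type u} [Category.{v} E] [HasFiniteLimits E] {U : Univ E} {D : E}

/-- Interpretations of an inductive-recursive definition whose constructors are indexed by an
arbitrary type. -/
structure IRFamAlg {I : Type} (code : I → IRCode U D (⊤_ E)) where
  X : E
  T : X ⟶ D
  intro : ∀ (i : I) {Δ : E} {γ : Δ ⟶ ⊤_ E}, (code i).Arg T γ → (Δ ⟶ X)
  intro_subst : ∀ (i : I) {Δ Δ' : E} (τ : Δ' ⟶ Δ) {γ : Δ ⟶ ⊤_ E}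
    (x : (code i).Arg T γ), τ ≫ intro i x = intro i ((code i).subst T τ x)
  intro_T : ∀ (i : I) {Δ : E} {γ : Δ ⟶ ⊤_ E} (x : (code i).Arg T γ),
    intro i x ≫ T = (code i).val T x

/-- Initiality among the interpretations of an inductive-recursive definition. -/
def IRFamAlg.IsInitial {I : Type} {code : I → IRCode U D (⊤_ E)} (A : IRFamAlg code) : Prop :=
  ∀ B : IRFamAlg code, ∃! f : A.X ⟶ B.X, ∃ hf : f ≫ B.T = A.T,
    ∀ (i : I) {Δ : E} {γ : Δ ⟶ ⊤_ E} (x : (code i).Arg A.T γ),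
      A.intro i x ≫ f = B.intro i ((code i).map f hf x)

/-- Transport of arguments along an equality of shapes. -/
def IRCode.castArg {X : E} {T : X ⟶ D} {Γ Δ : E} {γ : Δ ⟶ Γ} {c c' : IRCode U D Γ} (h : c = c')
    (x : c.Arg T γ) : c'.Arg T γ := h ▸ x

theorem IRCode.castArg_subst {X : E} {T : X ⟶ D} {Γ Δ Δ' : E} (τ : Δ' ⟶ Δ) {γ : Δ ⟶ Γ}
    {c c' : IRCode U D Γ} (h : c = c') (x : c.Arg T γ) :
    castArg h (c.subst T τ x) = c'.subst T τ (castArg h x) := by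
  subst h; rfl

theorem IRCode.val_castArg {X : E} {T : X ⟶ D} {Γ Δ : E} {γ : Δ ⟶ Γ}
    {c c' : IRCode U D Γ} (h : c = c') (x : c.Arg T γ) : c'.val T (castArg h x) = c.val T x := by
  subst h; rfl

theorem IRCode.castArg_map {X Y : E} {T : X ⟶ D} {S : Y ⟶ D} (f : X ⟶ Y) (hf : f ≫ S = T)
    {Γ Δ : E} {γ : Δ ⟶ Γ} {c c' : IRCode U D Γ} (h : c = c') (x : c.Arg T γ) :
    castArg h (c.map f hf x) = c'.map f hf (castArg h x) := by
  subst h; rfl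

theorem IRCode.castArg_trans {X : E} {T : X ⟶ D} {Γ Δ : E} {γ : Δ ⟶ Γ} {c c' d : IRCode U D Γ}
    (h : c = c') (h' : c' = d) (x : c.Arg T γ) :
    castArg h' (castArg h x) = castArg (h.trans h') x := by
  subst h; rfl

theorem IRCode.castArg_castArg {X : E} {T : X ⟶ D} {Γ Δ : E} {γ : Δ ⟶ Γ} {c c' : IRCode U D Γ}
    (h : c = c') (h' : c' = c) (x : c.Arg T γ) : castArg h' (castArg h x) = x := by
  subst h; rfl

theorem IRAlg.intro_castArg {cs : List (IRCode U D (⊤_ E))} (A : IRAlg cs) {m n : Fin cs.length}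
    (e : m = n) (h : cs.get m = cs.get n) {Δ : E} {γ : Δ ⟶ ⊤_ E} (x : (cs.get m).Arg A.T γ) :
    A.intro n (IRCode.castArg h x) = A.intro m x := by
  subst e; rfl

theorem Univ.SupportsIR.exists_isInitial (hU : U.SupportsIR D) {I : Type} [Finite I]
    (code : I → IRCode U D (⊤_ E)) :
    ∃ A : IRFamAlg code, A.IsInitial ∧ U.Small (terminal.from A.X) := by
  obtain ⟨cs, ψ, hψ⟩ : ∃ (cs : List (IRCode U D (⊤_ E))) (ψ : Fin cs.length ≃ I),
      ∀ m, cs.get m = code (ψ m) := by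
    obtain ⟨n, ⟨e⟩⟩ := Finite.exists_equiv_fin I
    exact ⟨List.ofFn (code ∘ e.symm), (finCongr List.length_ofFn).trans e.symm, fun m => by simp; rfl⟩
  have hψ' : ∀ i, cs.get (ψ.symm i) = code i := fun i => by rw [hψ, ψ.apply_symm_apply]
  obtain ⟨A, hA, hsmall⟩ := hU cs
  refine ⟨{
    X := A.X
    T := A.T
    intro := fun i _ _ x => A.intro (ψ.symm i) (IRCode.castArg (hψ' i).symm x)
    intro_subst := fun i _ _ τ _ x => by rw [A.intro_subst, IRCode.castArg_subst]
    intro_T := fun i _ _ x => by rw [A.intro_T, IRCode.val_castArg] }, ?_, hsmall⟩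
  intro B
  let B' : IRAlg cs :=
    { X := B.X
      T := B.T
      intro := fun m _ _ x => B.intro (ψ m) (IRCode.castArg (hψ m) x)
      intro_subst := fun m _ _ τ _ x => by rw [B.intro_subst, IRCode.castArg_subst]
      intro_T := fun m _ _ x => by rw [B.intro_T, IRCode.val_castArg] }
  have key : ∀ (f : A.X ⟶ B.X) (hf : f ≫ B.T = A.T),
      (∀ (m : Fin cs.length) {Δ : E} {γ : Δ ⟶ ⊤_ E} (x : (cs.get m).Arg A.T γ),
        A.intro m x ≫ f = B'.intro m ((cs.get m).map f hf x)) ↔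
      ∀ (i : I) {Δ : E} {γ : Δ ⟶ ⊤_ E} (x : (code i).Arg A.T γ),
        A.intro (ψ.symm i) (IRCode.castArg (hψ' i).symm x) ≫ f =
          B.intro i ((code i).map f hf x) := by
    intro f hf
    constructor
    · intro H i
      obtain ⟨m, rfl⟩ := ψ.surjective i
      intro Δ γ x
      have e : m = ψ.symm (ψ m) := (ψ.symm_apply_apply m).symm
      have hx := A.intro_castArg e (by rw [← e]) (IRCode.castArg (hψ m).symm x)
      have hx' : IRCode.castArg (by rw [← e]) (IRCode.castArg (hψ m).symm x) =
          IRCode.castArg (hψ' (ψ m)).symm x := IRCode.castArg_trans _ _ _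
      rw [← hx', hx, H]
      change B.intro (ψ m) _ = _
      rw [IRCode.castArg_map, IRCode.castArg_castArg]
    · intro H m Δ γ x
      have e : m = ψ.symm (ψ m) := (ψ.symm_apply_apply m).symm
      have hx := A.intro_castArg e (by rw [← e]) x
      have hx' : IRCode.castArg (by rw [← e]) x =
          IRCode.castArg (hψ' (ψ m)).symm (IRCode.castArg (hψ m) x) :=
        (IRCode.castArg_trans _ _ _).symm
      rw [← hx, hx', H]
      change _ = B.intro (ψ m) _
      rw [IRCode.castArg_map]
  obtain ⟨f, ⟨hf, H⟩, uniq⟩ := hA B'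
  exact ⟨f, ⟨hf, (key f hf).1 H⟩, fun g ⟨hg, G⟩ => uniq g ⟨hg, (key g hg).2 G⟩⟩

end IndexedInductionRecursion

/-! ### Constructor shapes of a universe and their arguments -/

section UniverseConstructors

variable {E : Type u} [Category.{v} E] [HasFiniteLimits E]

/-- The constructors of a universe with constants indexed by `J`. -/
inductive Ctor (J : Type) : Type
  | pi : Ctor J
  | sigma : Ctor J
  | eq : Ctor J
  | unit : Ctor J
  | bool : Ctor J
  | const (j : J) : Ctor J

instance {J : Type} [Finite J] : Finite (Ctor J) := by
  refine Finite.of_surjective (fun x : Fin 5 ⊕ J => match x with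
    | .inl 0 => Ctor.pi
    | .inl 1 => Ctor.sigma
    | .inl 2 => Ctor.eq
    | .inl 3 => Ctor.unit
    | .inl 4 => Ctor.bool
    | .inr j => Ctor.const j) ?_
  rintro (_ | _ | _ | _ | _ | j)
  exacts [⟨.inl 0, rfl⟩, ⟨.inl 1, rfl⟩, ⟨.inl 2, rfl⟩, ⟨.inl 3, rfl⟩, ⟨.inl 4, rfl⟩, ⟨.inr j, rfl⟩]

theorem Univ.Decodes.isIso_proj {U : Univ E} {e : ⊤_ E ⟶ U.Ty} (he : U.Decodes e (𝟙 (⊤_ E)))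
    {Δ : E} (γ : Δ ⟶ ⊤_ E) : IsIso (U.proj (γ ≫ e)) := by
  obtain ⟨i, hi⟩ := (he.subst (IsPullback.of_id_snd (f := γ))).exists_iso
    (decodes_proj (γ ≫ e))
  rw [← hi]
  infer_instance

/-- Functions on the unit type. -/
noncomputable def FunCtx.unit {U : Univ E} {e : ⊤_ E ⟶ U.Ty} (he : U.Decodes e (𝟙 (⊤_ E))) (D : E) :
    FunCtx U D e where
  obj := D
  proj := terminal.from D
  ev := U.proj _
  universal {Δ} γ g := by
    have := he.isIso_proj γ
    refine ⟨inv (U.proj (γ ≫ e)) ≫ g, ⟨Subsingleton.elim _ _, ?_⟩, ?_⟩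
    · rw [Univ.extMap_fst, IsIso.hom_inv_id_assoc]
    · rintro γ' ⟨h, h'⟩
      rw [Univ.extMap_fst] at h'
      rw [← h', IsIso.inv_hom_id_assoc]

theorem FunCtx.hom_ext {U : Univ E} {D Γ : E} {a : Γ ⟶ U.Ty} (F : FunCtx U D a) {Δ : E}
    {γ : Δ ⟶ Γ} {g : U.ext (γ ≫ a) ⟶ D} {δ δ' : Δ ⟶ F.obj}
    (h₁ : ∃ h : δ ≫ F.proj = γ, U.extMap δ (by rw [← h, Category.assoc]) ≫ F.ev = g)
    (h₂ : ∃ h : δ' ≫ F.proj = γ, U.extMap δ' (by rw [← h, Category.assoc]) ≫ F.ev = g) : δ = δ' :=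
  (F.universal γ g).unique h₁ h₂

/-- What is needed to define a universe over `B` by induction-recursion in `U'`. -/
structure IRSetup {J : Type} {K : J → E} (B : CodedUniv K) (U' : Univ E) where
  h : Univ.Hom B.U U'
  e : ⊤_ E ⟶ U'.Ty
  he : U'.Decodes e (𝟙 (⊤_ E))
  F : FunCtx U' B.U.Ty h.ty
  a : J → (⊤_ E ⟶ U'.Ty)
  i : ∀ j, U'.ext (a j) ≅ K j

namespace IRSetup

variable {J : Type} {K : J → E} {B : CodedUniv K} {U' : Univ E} (S : IRSetup B U')

noncomputable def genFam : B.U.Fam S.F.obj where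
  dom := S.F.proj
  cod := (S.h.extIso (a := S.F.proj) rfl).inv ≫ S.F.ev

/-- The constructor shape `A : X, B : T A → X`. -/
noncomputable def famCode (d : S.F.obj ⟶ B.U.Ty) : IRCode U' B.U.Ty (⊤_ E) :=
  -- An inductive argument indexed by the unit type is a single `A : X`. The context is then
  -- `B.U.Ty`, with `T A` as its generic point, and `S.h.ty` is the code in `U'` of `El (T A)`.
  .delta S.e (.unit S.he B.U.Ty) (.delta S.h.ty S.F (.iota d))

/-- The generic pair of elements of a code. -/
noncomputable def genPair : B.U.Pair (U'.ext (U'.proj S.h.ty ≫ S.h.ty)) where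
  lhs := S.h.isPullback.lift (U'.proj (U'.proj S.h.ty ≫ S.h.ty) ≫ pullback.snd S.h.ty U'.p)
    (U'.proj (U'.proj S.h.ty ≫ S.h.ty) ≫ U'.proj S.h.ty)
    (by rw [Category.assoc, Category.assoc, pullback.condition])
  rhs := S.h.isPullback.lift (pullback.snd (U'.proj S.h.ty ≫ S.h.ty) U'.p)
    (U'.proj (U'.proj S.h.ty ≫ S.h.ty) ≫ U'.proj S.h.ty)
    (by rw [← pullback.condition, Category.assoc])
  eq := by rw [IsPullback.lift_snd, IsPullback.lift_snd]

/-- The constructor shape `A : X, a : T A, b : T A`. -/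
noncomputable def pairCode (d : U'.ext (U'.proj S.h.ty ≫ S.h.ty) ⟶ B.U.Ty) :
    IRCode U' B.U.Ty (⊤_ E) :=
  .delta S.e (.unit S.he B.U.Ty)
    (.sigma S.h.ty (.sigma (U'.proj S.h.ty ≫ S.h.ty) (.iota d)))

/-- The shapes of the constructors of a universe over `B`. -/
noncomputable def code : Ctor J → IRCode U' B.U.Ty (⊤_ E)
  | .pi => S.famCode (B.codes.pi S.genFam)
  | .sigma => S.famCode (B.codes.sigma S.genFam)
  | .eq => S.pairCode (B.codes.eq S.genPair)
  | .unit => .iota B.codes.unit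
  | .bool => .iota B.codes.bool
  | .const j => .sigma (S.a j) (.iota ((S.i j).hom ≫ B.const j))

variable {V W : Univ E} (t : Univ.Hom V B.U)

theorem famArg_aux {Δ : E} (x : V.Fam Δ) :
    (x.dom ≫ t.ty) ≫ S.h.ty = x.dom ≫ (t.comp S.h).ty :=
  Category.assoc _ _ _

/-- The arguments given by a family of codes. -/
noncomputable def famArg (d : S.F.obj ⟶ B.U.Ty) {Δ : E} (γ : Δ ⟶ ⊤_ E) (x : V.Fam Δ) :
    (S.famCode d).Arg t.ty γ :=
  ⟨U'.proj (γ ≫ S.e) ≫ x.dom,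
    ⟨x.dom ≫ t.ty, Subsingleton.elim _ _, by
      rw [Category.assoc (U'.proj (γ ≫ S.e))]; exact Univ.extMap_fst _ _⟩,
    ((t.comp S.h).extIso (S.famArg_aux t x)).hom ≫ x.cod,
    ⟨Classical.choose (S.F.universal (x.dom ≫ t.ty)
      ((((t.comp S.h).extIso (S.famArg_aux t x)).hom ≫ x.cod) ≫ t.ty)).exists,
      Classical.choose_spec (S.F.universal (x.dom ≫ t.ty)
      ((((t.comp S.h).extIso (S.famArg_aux t x)).hom ≫ x.cod) ≫ t.ty)).exists⟩, PUnit.unit⟩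

/-- Only the two inductive arguments carry information. The other components record values of `T`,
which the universal properties of the function contexts determine. -/
theorem famArg_eq (d : S.F.obj ⟶ B.U.Ty) {Δ : E} (γ : Δ ⟶ ⊤_ E) (x : V.Fam Δ)
    (y : (S.famCode d).Arg t.ty γ) (h₁ : y.1 = U'.proj (γ ≫ S.e) ≫ x.dom)
    (h₂ : ∀ hb : y.2.1.1 ≫ S.h.ty = x.dom ≫ (t.comp S.h).ty,
      y.2.2.1 = ((t.comp S.h).extIso hb).hom ≫ x.cod) : S.famArg t d γ x = y := by
  obtain ⟨g, ⟨A, hA⟩, g₂, ⟨n, hn⟩, ⟨⟩⟩ := y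
  obtain rfl : g = _ := h₁
  have := S.he.isIso_proj γ
  obtain rfl : A = x.dom ≫ t.ty := by
    obtain ⟨_, hA⟩ := hA
    rw [Category.assoc] at hA
    exact (cancel_epi (U'.proj (γ ≫ S.e))).1 ((Univ.extMap_fst _ _).symm.trans hA)
  obtain rfl : g₂ = ((t.comp S.h).extIso (S.famArg_aux t x)).hom ≫ x.cod :=
    h₂ (S.famArg_aux t x)
  obtain rfl : n = _ := S.F.hom_ext hn (Classical.choose_spec (S.F.universal (x.dom ≫ t.ty)
      ((((t.comp S.h).extIso (S.famArg_aux t x)).hom ≫ x.cod) ≫ t.ty)).exists)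
  rfl

theorem famArg_bijective (d : S.F.obj ⟶ B.U.Ty) {Δ : E} (γ : Δ ⟶ ⊤_ E) :
    Function.Bijective (S.famArg t d γ) := by
  have := S.he.isIso_proj γ
  constructor
  · rintro ⟨d₁, c₁⟩ ⟨d₂, c₂⟩ h
    have h₁ : U'.proj (γ ≫ S.e) ≫ d₁ = U'.proj (γ ≫ S.e) ≫ d₂ := congrArg Sigma.fst h
    obtain rfl : d₁ = d₂ := (cancel_epi _).1 h₁
    obtain ⟨-, h⟩ := Sigma.mk.inj_iff.1 h
    obtain ⟨-, h⟩ := Sigma.mk.inj_iff.1 (eq_of_heq h)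
    obtain ⟨h, -⟩ := Sigma.mk.inj_iff.1 (eq_of_heq h)
    obtain rfl : c₁ = c₂ :=
      (cancel_epi ((t.comp S.h).extIso (S.famArg_aux t ⟨d₁, c₁⟩)).hom).1 h
    rfl
  · intro y
    have hA : y.2.1.1 = (inv (U'.proj (γ ≫ S.e)) ≫ y.1) ≫ t.ty := by
      obtain ⟨_, hA⟩ := y.2.1.2
      exact ((IsIso.eq_inv_comp _).2 ((Univ.extMap_fst _ _).symm.trans hA)).trans
        (Category.assoc _ _ _).symm
    have hb : y.2.1.1 ≫ S.h.ty = (inv (U'.proj (γ ≫ S.e)) ≫ y.1) ≫ (t.comp S.h).ty :=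
      (congrArg (· ≫ S.h.ty) hA).trans (Category.assoc _ _ _)
    refine ⟨⟨inv (U'.proj (γ ≫ S.e)) ≫ y.1, ((t.comp S.h).extIso hb).inv ≫ y.2.2.1⟩,
      S.famArg_eq t d γ _ y ?_ ?_⟩
    · rw [IsIso.hom_inv_id_assoc]
    · intro _
      rw [Iso.hom_inv_id_assoc]

theorem subst_famArg (d : S.F.obj ⟶ B.U.Ty) {Δ Δ' : E} (τ : Δ' ⟶ Δ) (γ : Δ ⟶ ⊤_ E)
    (x : V.Fam Δ) :
    (S.famCode d).subst t.ty τ (S.famArg t d γ x) = S.famArg t d (τ ≫ γ) (x.subst τ) := by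
  symm
  apply famArg_eq
  · exact Univ.extMap_fst_assoc _ _ _
  · intro hb
    exact ((t.comp S.h).extIso_hom_extMap_assoc τ (S.famArg_aux t x) hb rfl
      (Category.assoc _ _ _) x.cod).symm

theorem map_famArg (d : S.F.obj ⟶ B.U.Ty) {Δ : E} (γ : Δ ⟶ ⊤_ E) (x : V.Fam Δ)
    (t' : Univ.Hom W B.U) (f : Univ.Hom V W) (w : f.comp t' = t) (hf : f.ty ≫ t'.ty = t.ty) :
    (S.famCode d).map f.ty hf (S.famArg t d γ x) = S.famArg t' d γ (f.fam x) := by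
  subst w
  symm
  apply famArg_eq
  · exact Category.assoc _ _ _
  · intro hb
    have e := S.famArg_aux (f.comp t') x
    have key : ∀ (k : Univ.Hom V U') (hk : f.comp (t'.comp S.h) = k)
        (e : (x.dom ≫ (f.comp t').ty) ≫ S.h.ty = x.dom ≫ k.ty),
        (k.extIso e).hom = ((t'.comp S.h).extIso hb).hom ≫ (f.extIso (a := x.dom) rfl).hom := by
      rintro k rfl e
      exact (f.extIso_hom_comp (t'.comp S.h) rfl hb e).symm
    refine (Category.assoc _ _ _).trans ?_
    refine (congrArg (· ≫ x.cod ≫ f.ty) (key _ (Univ.Hom.comp_assoc _ _ _).symm e)).trans ?_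
    exact Category.assoc _ _ _

/-- For `op = pi` this turns the defining equation of `T` into `T (pi A B) = pi (T A) (T ∘ B)`: the
arguments determine the point `n` of `S.F.obj` at which `genFam` becomes `t.fam x`. -/
theorem val_famArg (op : ∀ {Γ : E}, B.U.Fam Γ → (Γ ⟶ B.U.Ty))
    (hop : ∀ {Γ Δ : E} (τ : Δ ⟶ Γ) (x : B.U.Fam Γ), τ ≫ op x = op (x.subst τ))
    {Δ : E} (γ : Δ ⟶ ⊤_ E) (x : V.Fam Δ) :
    (S.famCode (op S.genFam)).val t.ty (S.famArg t (op S.genFam) γ x) = op (t.fam x) := by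
  obtain ⟨h₁, h₂⟩ := (S.famArg t (op S.genFam) γ x).2.2.2.1.2
  change (S.famArg t (op S.genFam) γ x).2.2.2.1.1 ≫ op S.genFam = _
  generalize (S.famArg t (op S.genFam) γ x).2.2.2.1.1 = n at h₁ h₂ ⊢
  replace h₁ : n ≫ S.F.proj = x.dom ≫ t.ty := h₁
  rw [hop]
  congr 1
  refine Univ.Fam.mk_eq_mk (d := n ≫ S.F.proj)
    (c := B.U.extMap n rfl ≫ (S.h.extIso (a := S.F.proj) rfl).inv ≫ S.F.ev)
    (by rw [h₁, Category.id_comp]) ?_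
  have hn : (x.dom ≫ t.ty) ≫ S.h.ty = n ≫ S.F.proj ≫ S.h.ty := by rw [← h₁, Category.assoc]
  have h₃ := S.h.extIso_hom_extMap n (a := S.F.proj) rfl (a' := x.dom ≫ t.ty) rfl h₁.symm hn
  have h₄ : B.U.extMap n h₁.symm ≫ (S.h.extIso (a := S.F.proj) rfl).inv =
      (S.h.extIso rfl).inv ≫ U'.extMap n hn := by
    rw [Iso.eq_inv_comp, reassoc_of% h₃, Iso.hom_inv_id, Category.comp_id]
  have h₅ : U'.extMap n hn ≫ S.F.ev =
      (((t.comp S.h).extIso (S.famArg_aux t x)).hom ≫ x.cod) ≫ t.ty := h₂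
  have h₆ := Univ.Hom.extIso_hom_comp t S.h (a := x.dom) rfl rfl (S.famArg_aux t x)
  rw [Univ.extMap_trans_assoc, Univ.extMap_congr (Category.id_comp n) _ h₁.symm, reassoc_of% h₄, h₅,
    Iso.inv_comp_eq, ← h₆]
  simp only [Category.assoc]
  rfl

theorem pairArg_aux {Δ : E} (x : V.Pair Δ) :
    (x.lhs ≫ V.p ≫ t.ty) ≫ S.h.ty = (x.lhs ≫ (t.comp S.h).el) ≫ U'.p := by
  rw [Category.assoc x.lhs (t.comp S.h).el, (t.comp S.h).isPullback.w, Category.assoc,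
    Category.assoc]
  rfl

theorem pairArg_aux' {Δ : E} (x : V.Pair Δ) :
    pullback.lift _ _ (S.pairArg_aux t x) ≫ U'.proj S.h.ty ≫ S.h.ty =
      (x.rhs ≫ (t.comp S.h).el) ≫ U'.p := by
  rw [pullback.lift_fst_assoc, S.pairArg_aux t x, Category.assoc x.lhs, Category.assoc x.rhs,
    (t.comp S.h).isPullback.w, ← Category.assoc, ← Category.assoc, x.eq]

/-- The arguments given by a pair of elements of a code. -/
noncomputable def pairArg (d : U'.ext (U'.proj S.h.ty ≫ S.h.ty) ⟶ B.U.Ty) {Δ : E} (γ : Δ ⟶ ⊤_ E)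
    (x : V.Pair Δ) : (S.pairCode d).Arg t.ty γ :=
  ⟨U'.proj (γ ≫ S.e) ≫ x.lhs ≫ V.p,
    ⟨x.lhs ≫ V.p ≫ t.ty, Subsingleton.elim _ _,
      (Univ.extMap_fst _ _).trans (by simp only [Category.assoc]; rfl)⟩,
    ⟨pullback.lift _ _ (S.pairArg_aux t x), pullback.lift_fst _ _ _⟩,
    ⟨pullback.lift _ _ (S.pairArg_aux' t x), pullback.lift_fst _ _ _⟩, PUnit.unit⟩

theorem pairArg_eq (d : U'.ext (U'.proj S.h.ty ≫ S.h.ty) ⟶ B.U.Ty) {Δ : E} (γ : Δ ⟶ ⊤_ E)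
    (x : V.Pair Δ) (y : (S.pairCode d).Arg t.ty γ)
    (h₁ : y.1 = U'.proj (γ ≫ S.e) ≫ x.lhs ≫ V.p)
    (h₂ : y.2.2.1.1 ≫ pullback.snd S.h.ty U'.p = x.lhs ≫ (t.comp S.h).el)
    (h₃ : y.2.2.2.1.1 ≫ pullback.snd (U'.proj S.h.ty ≫ S.h.ty) U'.p = x.rhs ≫ (t.comp S.h).el) :
    S.pairArg t d γ x = y := by
  obtain ⟨g, ⟨A, hA⟩, ⟨γ₁, h₁'⟩, ⟨γ₂, h₂'⟩, ⟨⟩⟩ := y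
  obtain rfl : g = _ := h₁
  have := S.he.isIso_proj γ
  obtain rfl : A = x.lhs ≫ V.p ≫ t.ty := by
    obtain ⟨_, hA⟩ := hA
    rw [Category.assoc, Category.assoc] at hA
    exact (cancel_epi (U'.proj (γ ≫ S.e))).1 ((Univ.extMap_fst _ _).symm.trans hA)
  obtain rfl : γ₁ = pullback.lift _ _ (S.pairArg_aux t x) := by
    apply pullback.hom_ext
    · exact h₁'.trans (pullback.lift_fst _ _ _).symm
    · exact h₂.trans (pullback.lift_snd _ _ _).symm
  obtain rfl : γ₂ = pullback.lift _ _ (S.pairArg_aux' t x) := by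
    apply pullback.hom_ext
    · exact h₂'.trans (pullback.lift_fst _ _ _).symm
    · exact h₃.trans (pullback.lift_snd _ _ _).symm
  rfl

theorem proj_eq_of_proj {Γ Δ : E} {a : Γ ⟶ U'.Ty} {A : Δ ⟶ Γ} (δ : Δ ⟶ U'.ext a)
    (h : δ ≫ U'.proj a = A) : (δ ≫ pullback.snd a U'.p) ≫ U'.p = A ≫ a := by
  rw [← h, Category.assoc, Category.assoc, pullback.condition]

theorem pairArg_bijective (d : U'.ext (U'.proj S.h.ty ≫ S.h.ty) ⟶ B.U.Ty) {Δ : E}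
    (γ : Δ ⟶ ⊤_ E) : Function.Bijective (S.pairArg t d γ) := by
  have := S.he.isIso_proj γ
  constructor
  · intro x y h
    have h₁ : U'.proj (γ ≫ S.e) ≫ x.lhs ≫ V.p = U'.proj (γ ≫ S.e) ≫ y.lhs ≫ V.p :=
      congrArg Sigma.fst h
    replace h₁ := (cancel_epi _).1 h₁
    have h₂ : x.lhs ≫ (t.comp S.h).el = y.lhs ≫ (t.comp S.h).el := by
      have := congrArg (fun z : (S.pairCode d).Arg t.ty γ =>
        z.2.2.1.1 ≫ pullback.snd S.h.ty U'.p) h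
      exact (pullback.lift_snd _ _ _).symm.trans (this.trans (pullback.lift_snd _ _ _))
    have h₃ : x.rhs ≫ (t.comp S.h).el = y.rhs ≫ (t.comp S.h).el := by
      have := congrArg (fun z : (S.pairCode d).Arg t.ty γ =>
        z.2.2.2.1.1 ≫ pullback.snd (U'.proj S.h.ty ≫ S.h.ty) U'.p) h
      exact (pullback.lift_snd _ _ _).symm.trans (this.trans (pullback.lift_snd _ _ _))
    apply Univ.Pair.ext
    · exact (t.comp S.h).isPullback.hom_ext h₂ h₁
    · exact (t.comp S.h).isPullback.hom_ext h₃ (by rw [← x.eq, ← y.eq, h₁])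
  · intro y
    have hA : y.2.1.1 = (inv (U'.proj (γ ≫ S.e)) ≫ y.1) ≫ t.ty := by
      obtain ⟨_, hA⟩ := y.2.1.2
      exact ((IsIso.eq_inv_comp _).2 ((Univ.extMap_fst _ _).symm.trans hA)).trans
        (Category.assoc _ _ _).symm
    have hb : y.2.1.1 ≫ S.h.ty = (inv (U'.proj (γ ≫ S.e)) ≫ y.1) ≫ (t.comp S.h).ty :=
      (congrArg (· ≫ S.h.ty) hA).trans (Category.assoc _ _ _)
    have e₁ : (y.2.2.1.1 ≫ pullback.snd S.h.ty U'.p) ≫ U'.p =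
        (inv (U'.proj (γ ≫ S.e)) ≫ y.1) ≫ (t.comp S.h).ty := by
      rw [← hb]
      exact proj_eq_of_proj y.2.2.1.1 y.2.2.1.2
    have e₂ : (y.2.2.2.1.1 ≫ pullback.snd (U'.proj S.h.ty ≫ S.h.ty) U'.p) ≫ U'.p =
        (inv (U'.proj (γ ≫ S.e)) ≫ y.1) ≫ (t.comp S.h).ty := by
      rw [← hb]
      refine (proj_eq_of_proj y.2.2.2.1.1 y.2.2.2.1.2).trans ?_
      exact (Category.assoc _ _ _).symm.trans (congrArg (· ≫ S.h.ty) y.2.2.1.2)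
    refine ⟨⟨(t.comp S.h).isPullback.lift _ _ e₁, (t.comp S.h).isPullback.lift _ _ e₂,
      (IsPullback.lift_snd _ _ _ _).trans (IsPullback.lift_snd _ _ _ _).symm⟩,
      S.pairArg_eq t d γ _ y ?_ ?_ ?_⟩
    · rw [IsPullback.lift_snd, IsIso.hom_inv_id_assoc]
    · exact (IsPullback.lift_fst _ _ _ _).symm
    · exact (IsPullback.lift_fst _ _ _ _).symm

theorem subst_pairArg (d : U'.ext (U'.proj S.h.ty ≫ S.h.ty) ⟶ B.U.Ty) {Δ Δ' : E} (τ : Δ' ⟶ Δ)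
    (γ : Δ ⟶ ⊤_ E) (x : V.Pair Δ) :
    (S.pairCode d).subst t.ty τ (S.pairArg t d γ x) = S.pairArg t d (τ ≫ γ) (x.subst τ) := by
  symm
  apply pairArg_eq
  · exact (Univ.extMap_fst_assoc _ _ _).trans (congrArg _ (Category.assoc _ _ _).symm)
  · exact (Category.assoc _ _ _).trans ((congrArg (τ ≫ ·) (pullback.lift_snd _ _ _)).trans
      (Category.assoc _ _ _).symm)
  · exact (Category.assoc _ _ _).trans ((congrArg (τ ≫ ·) (pullback.lift_snd _ _ _)).trans
      (Category.assoc _ _ _).symm)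

theorem map_pairArg (d : U'.ext (U'.proj S.h.ty ≫ S.h.ty) ⟶ B.U.Ty) {Δ : E} (γ : Δ ⟶ ⊤_ E)
    (x : V.Pair Δ) (t' : Univ.Hom W B.U) (f : Univ.Hom V W) (w : f.comp t' = t)
    (hf : f.ty ≫ t'.ty = t.ty) :
    (S.pairCode d).map f.ty hf (S.pairArg t d γ x) = S.pairArg t' d γ (f.pair x) := by
  subst w
  symm
  apply pairArg_eq
  · change (U'.proj (γ ≫ S.e) ≫ x.lhs ≫ V.p) ≫ f.ty = U'.proj (γ ≫ S.e) ≫ (x.lhs ≫ f.el) ≫ W.p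
    rw [Category.assoc, Category.assoc, Category.assoc, f.isPullback.w]
  · refine (pullback.lift_snd _ _ _).trans ?_
    rw [Univ.Hom.comp_assoc]
    exact (Category.assoc _ _ _).symm
  · refine (pullback.lift_snd _ _ _).trans ?_
    rw [Univ.Hom.comp_assoc]
    exact (Category.assoc _ _ _).symm

theorem val_pairArg (op : ∀ {Γ : E}, B.U.Pair Γ → (Γ ⟶ B.U.Ty))
    (hop : ∀ {Γ Δ : E} (τ : Δ ⟶ Γ) (x : B.U.Pair Γ), τ ≫ op x = op (x.subst τ))
    {Δ : E} (γ : Δ ⟶ ⊤_ E) (x : V.Pair Δ) :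
    (S.pairCode (op S.genPair)).val t.ty (S.pairArg t (op S.genPair) γ x) = op (t.pair x) := by
  change pullback.lift _ _ (S.pairArg_aux' t x) ≫ op S.genPair = _
  rw [hop]
  congr 1
  apply Univ.Pair.ext
  · apply S.h.isPullback.hom_ext
    · change (pullback.lift _ _ (S.pairArg_aux' t x) ≫ S.h.isPullback.lift _ _ _) ≫ S.h.el =
        (x.lhs ≫ t.el) ≫ S.h.el
      rw [Category.assoc, IsPullback.lift_fst, pullback.lift_fst_assoc, pullback.lift_snd,
        Category.assoc]
      rfl
    · change (pullback.lift _ _ (S.pairArg_aux' t x) ≫ S.h.isPullback.lift _ _ _) ≫ B.U.p =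
        (x.lhs ≫ t.el) ≫ B.U.p
      rw [Category.assoc, IsPullback.lift_snd, pullback.lift_fst_assoc, pullback.lift_fst,
        Category.assoc, t.isPullback.w]
  · apply S.h.isPullback.hom_ext
    · change (pullback.lift _ _ (S.pairArg_aux' t x) ≫ S.h.isPullback.lift _ _ _) ≫ S.h.el =
        (x.rhs ≫ t.el) ≫ S.h.el
      rw [Category.assoc, IsPullback.lift_fst, pullback.lift_snd, Category.assoc]
      rfl
    · change (pullback.lift _ _ (S.pairArg_aux' t x) ≫ S.h.isPullback.lift _ _ _) ≫ B.U.p =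
        (x.rhs ≫ t.el) ≫ B.U.p
      rw [Category.assoc, IsPullback.lift_snd, pullback.lift_fst_assoc, pullback.lift_fst,
        Category.assoc, t.isPullback.w, ← Category.assoc, ← Category.assoc, x.eq]

end IRSetup

end UniverseConstructors

end TarskiUniverse

namespace TarskiUniverse

/-! ### Inductive-recursive interpretations as universes over a base -/

section InitialUniverses

variable {E : Type u} [Category.{v} E] [HasFiniteLimits E]

namespace IRSetup

variable {J : Type} {K : J → E} {B : CodedUniv K} {U' : Univ E} (S : IRSetup B U')

variable {V W : Univ E} (t : Univ.Hom V B.U)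

/-- Families of codes correspond to arguments. -/
noncomputable def famEquiv (d : S.F.obj ⟶ B.U.Ty) {Δ : E} (γ : Δ ⟶ ⊤_ E) :
    V.Fam Δ ≃ (S.famCode d).Arg t.ty γ :=
  Equiv.ofBijective _ (S.famArg_bijective t d γ)

/-- Pairs of elements of a code correspond to arguments. -/
noncomputable def pairEquiv (d : U'.ext (U'.proj S.h.ty ≫ S.h.ty) ⟶ B.U.Ty) {Δ : E}
    (γ : Δ ⟶ ⊤_ E) : V.Pair Δ ≃ (S.pairCode d).Arg t.ty γ :=
  Equiv.ofBijective _ (S.pairArg_bijective t d γ)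

/-- Elements of `K j` correspond to arguments. -/
noncomputable def constEquiv {X : E} (T : X ⟶ B.U.Ty) (j : J) {Δ : E} (γ : Δ ⟶ ⊤_ E) :
    (Δ ⟶ K j) ≃ (S.code (.const j)).Arg T γ where
  toFun x := ⟨⟨x ≫ (S.i j).inv, Subsingleton.elim _ _⟩, PUnit.unit⟩
  invFun y := y.1.1 ≫ (S.i j).hom
  left_inv x := by simp
  right_inv y := by
    have e : (y.1.1 ≫ (S.i j).hom) ≫ (S.i j).inv = y.1.1 := by simp
    exact Sigma.ext (Subtype.ext e) HEq.rfl

theorem subst_famEquiv_symm (d : S.F.obj ⟶ B.U.Ty) {Δ Δ' : E} (τ : Δ' ⟶ Δ) (γ : Δ ⟶ ⊤_ E)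
    (y : (S.famCode d).Arg t.ty γ) :
    ((S.famEquiv t d γ).symm y).subst τ =
      (S.famEquiv t d (τ ≫ γ)).symm ((S.famCode d).subst t.ty τ y) := by
  obtain ⟨x, rfl⟩ := (S.famEquiv t d γ).surjective y
  rw [Equiv.symm_apply_apply, Equiv.eq_symm_apply]
  exact (S.subst_famArg t d τ γ x).symm

theorem subst_pairEquiv_symm (d : U'.ext (U'.proj S.h.ty ≫ S.h.ty) ⟶ B.U.Ty) {Δ Δ' : E}
    (τ : Δ' ⟶ Δ) (γ : Δ ⟶ ⊤_ E) (y : (S.pairCode d).Arg t.ty γ) :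
    ((S.pairEquiv t d γ).symm y).subst τ =
      (S.pairEquiv t d (τ ≫ γ)).symm ((S.pairCode d).subst t.ty τ y) := by
  obtain ⟨x, rfl⟩ := (S.pairEquiv t d γ).surjective y
  rw [Equiv.symm_apply_apply, Equiv.eq_symm_apply]
  exact (S.subst_pairArg t d τ γ x).symm

theorem famEquiv_symm_map (d : S.F.obj ⟶ B.U.Ty) {Δ : E} (γ : Δ ⟶ ⊤_ E) (x : V.Fam Δ)
    (t' : Univ.Hom W B.U) (f : Univ.Hom V W) (w : f.comp t' = t) (hf : f.ty ≫ t'.ty = t.ty) :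
    (S.famEquiv t' d γ).symm ((S.famCode d).map f.ty hf (S.famArg t d γ x)) = f.fam x := by
  rw [Equiv.symm_apply_eq]
  exact S.map_famArg t d γ x t' f w hf

theorem pairEquiv_symm_map (d : U'.ext (U'.proj S.h.ty ≫ S.h.ty) ⟶ B.U.Ty) {Δ : E}
    (γ : Δ ⟶ ⊤_ E) (x : V.Pair Δ) (r : Univ.Hom W B.U) (f : Univ.Hom V W) (w : f.comp r = t)
    (hf : f.ty ≫ r.ty = t.ty) :
    (S.pairEquiv r d γ).symm ((S.pairCode d).map f.ty hf (S.pairArg t d γ x)) = f.pair x := by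
  rw [Equiv.symm_apply_eq]
  exact S.map_pairArg t d γ x r f w hf

/-- The introduction rules that are interpreted by a universe over `B`. -/
noncomputable def introOf (c : V.Codes) (const : ∀ j, K j ⟶ V.Ty) :
    ∀ (i : Ctor J) {Δ : E} {γ : Δ ⟶ ⊤_ E}, (S.code i).Arg t.ty γ → (Δ ⟶ V.Ty)
  | .pi, _, γ, y => c.pi ((S.famEquiv t (B.codes.pi S.genFam) γ).symm y)
  | .sigma, _, γ, y => c.sigma ((S.famEquiv t (B.codes.sigma S.genFam) γ).symm y)
  | .eq, _, γ, y => c.eq ((S.pairEquiv t (B.codes.eq S.genPair) γ).symm y)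
  | .unit, _, γ, _ => γ ≫ c.unit
  | .bool, _, γ, _ => γ ≫ c.bool
  | .const j, _, γ, y => (S.constEquiv t.ty j γ).symm y ≫ const j

/-- A universe over `B` interprets the introduction rules. -/
noncomputable def algOf (C : CodedUniv K) (k : Univ.Hom C.U B.U) (hk : CodedUniv.IsHom C B k) :
    IRFamAlg S.code where
  X := C.U.Ty
  T := k.ty
  intro := S.introOf k C.codes C.const
  intro_subst i Δ Δ' τ γ y := by
    cases i with
    | pi =>
      exact (C.codes.pi_subst _ _).trans
        (congrArg C.codes.pi (S.subst_famEquiv_symm k _ τ γ y))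
    | sigma =>
      exact (C.codes.sigma_subst _ _).trans
        (congrArg C.codes.sigma (S.subst_famEquiv_symm k _ τ γ y))
    | eq =>
      exact (C.codes.eq_subst _ _).trans
        (congrArg C.codes.eq (S.subst_pairEquiv_symm k _ τ γ y))
    | unit => exact (Category.assoc _ _ _).symm
    | bool => exact (Category.assoc _ _ _).symm
    | const j =>
      exact (Category.assoc _ _ _).symm.trans
        (congrArg (· ≫ C.const j) (Category.assoc _ _ _).symm)
  intro_T i Δ γ y := by
    cases i with
    | pi =>
      obtain ⟨x, rfl⟩ := (S.famEquiv k (B.codes.pi S.genFam) γ).surjective y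
      refine Eq.trans ?_ (S.val_famArg k B.codes.pi B.codes.pi_subst γ x).symm
      refine (hk.strict.pi _).trans ?_
      rw [Equiv.symm_apply_apply]
    | sigma =>
      obtain ⟨x, rfl⟩ := (S.famEquiv k (B.codes.sigma S.genFam) γ).surjective y
      refine Eq.trans ?_ (S.val_famArg k B.codes.sigma B.codes.sigma_subst γ x).symm
      refine (hk.strict.sigma _).trans ?_
      rw [Equiv.symm_apply_apply]
    | eq =>
      obtain ⟨x, rfl⟩ := (S.pairEquiv k (B.codes.eq S.genPair) γ).surjective y
      refine Eq.trans ?_ (S.val_pairArg k B.codes.eq B.codes.eq_subst γ x).symm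
      refine (hk.strict.eq _).trans ?_
      rw [Equiv.symm_apply_apply]
    | unit => exact (Category.assoc _ _ _).trans (congrArg _ hk.strict.unit)
    | bool => exact (Category.assoc _ _ _).trans (congrArg _ hk.strict.bool)
    | const j =>
      exact (Category.assoc _ _ _).trans ((congrArg _ (hk.const j)).trans (Category.assoc _ _ _))

variable
  (intro : ∀ (i : Ctor J) {Δ : E} {γ : Δ ⟶ ⊤_ E}, (S.code i).Arg t.ty γ → (Δ ⟶ V.Ty))
  (intro_subst : ∀ (i : Ctor J) {Δ Δ' : E} (τ : Δ' ⟶ Δ) {γ : Δ ⟶ ⊤_ E}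
    (x : (S.code i).Arg t.ty γ), τ ≫ intro i x = intro i ((S.code i).subst t.ty τ x))

/-- The universe with codes that is given by an interpretation of the introduction rules. -/
noncomputable def codedUnivOf : CodedUniv K where
  U := V
  codes :=
    { pi := fun {Γ} x => intro .pi (S.famArg t (B.codes.pi S.genFam) (terminal.from Γ) x)
      sigma := fun {Γ} x => intro .sigma (S.famArg t (B.codes.sigma S.genFam) (terminal.from Γ) x)
      eq := fun {Γ} x => intro .eq (S.pairArg t (B.codes.eq S.genPair) (terminal.from Γ) x)
      unit := intro .unit (γ := 𝟙 _) PUnit.unit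
      bool := intro .bool (γ := 𝟙 _) PUnit.unit
      pi_subst := fun {Γ Δ} τ x => by
        refine (intro_subst .pi τ _).trans ((congrArg (intro .pi)
          (S.subst_famArg t (B.codes.pi S.genFam) τ (terminal.from Γ) x)).trans ?_)
        obtain e : τ ≫ terminal.from Γ = terminal.from Δ := Subsingleton.elim _ _
        rw [e]
      sigma_subst := fun {Γ Δ} τ x => by
        refine (intro_subst .sigma τ _).trans ((congrArg (intro .sigma)
          (S.subst_famArg t (B.codes.sigma S.genFam) τ (terminal.from Γ) x)).trans ?_)
        obtain e : τ ≫ terminal.from Γ = terminal.from Δ := Subsingleton.elim _ _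
        rw [e]
      eq_subst := fun {Γ Δ} τ x => by
        refine (intro_subst .eq τ _).trans ((congrArg (intro .eq)
          (S.subst_pairArg t (B.codes.eq S.genPair) τ (terminal.from Γ) x)).trans ?_)
        obtain e : τ ≫ terminal.from Γ = terminal.from Δ := Subsingleton.elim _ _
        rw [e] }
  const j := intro (.const j) (S.constEquiv t.ty j (terminal.from (K j)) (𝟙 (K j)))

theorem codedUnivOf_isHom
    (intro_T : ∀ (i : Ctor J) {Δ : E} {γ : Δ ⟶ ⊤_ E} (x : (S.code i).Arg t.ty γ),
      intro i x ≫ t.ty = (S.code i).val t.ty x) :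
    CodedUniv.IsHom (S.codedUnivOf t intro intro_subst) B t where
  strict :=
    { pi := fun x => (intro_T .pi _).trans (S.val_famArg t B.codes.pi B.codes.pi_subst _ x)
      sigma := fun x =>
        (intro_T .sigma _).trans (S.val_famArg t B.codes.sigma B.codes.sigma_subst _ x)
      eq := fun x => (intro_T .eq _).trans (S.val_pairArg t B.codes.eq B.codes.eq_subst _ x)
      unit := (intro_T .unit _).trans (Category.id_comp _)
      bool := (intro_T .bool _).trans (Category.id_comp _) }
  const j := (intro_T (.const j) _).trans (by
    change (𝟙 (K j) ≫ (S.i j).inv) ≫ (S.i j).hom ≫ B.const j = B.const j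
    simp)

/-- Compatibility with the introduction rules is compatibility with the codes. -/
theorem isHom_codedUnivOf_iff (C : CodedUniv K) (k : Univ.Hom C.U B.U)
    (f : Univ.Hom V C.U) (w : f.comp k = t) (hf : f.ty ≫ k.ty = t.ty) :
    CodedUniv.IsHom (S.codedUnivOf t intro intro_subst) C f ↔
      ∀ (i : Ctor J) {Δ : E} {γ : Δ ⟶ ⊤_ E} (x : (S.code i).Arg t.ty γ),
        intro i x ≫ f.ty = S.introOf k C.codes C.const i ((S.code i).map f.ty hf x) := by
  constructor
  · intro H i Δ γ y
    obtain rfl : γ = terminal.from Δ := Subsingleton.elim _ _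
    cases i with
    | pi =>
      obtain ⟨x, rfl⟩ := (S.famEquiv t (B.codes.pi S.genFam) _).surjective y
      exact (H.strict.pi x).trans
        (congrArg C.codes.pi (S.famEquiv_symm_map t _ _ x k f w hf).symm)
    | sigma =>
      obtain ⟨x, rfl⟩ := (S.famEquiv t (B.codes.sigma S.genFam) _).surjective y
      exact (H.strict.sigma x).trans
        (congrArg C.codes.sigma (S.famEquiv_symm_map t _ _ x k f w hf).symm)
    | eq =>
      obtain ⟨x, rfl⟩ := (S.pairEquiv t (B.codes.eq S.genPair) _).surjective y
      exact (H.strict.eq x).trans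
        (congrArg C.codes.eq (S.pairEquiv_symm_map t _ _ x k f w hf).symm)
    | unit =>
      -- Stability under substitution reduces the constructor in context `Δ` to its closed instance.
      have h := intro_subst .unit (terminal.from Δ) (γ := 𝟙 _) PUnit.unit
      have e : terminal.from Δ ≫ 𝟙 (⊤_ E) = terminal.from Δ := Subsingleton.elim _ _
      rw [e] at h
      refine (congrArg (· ≫ f.ty) h.symm).trans ((Category.assoc _ _ _).trans ?_)
      exact congrArg _ H.strict.unit
    | bool =>
      have h := intro_subst .bool (terminal.from Δ) (γ := 𝟙 _) PUnit.unit
      have e : terminal.from Δ ≫ 𝟙 (⊤_ E) = terminal.from Δ := Subsingleton.elim _ _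
      rw [e] at h
      refine (congrArg (· ≫ f.ty) h.symm).trans ((Category.assoc _ _ _).trans ?_)
      exact congrArg _ H.strict.bool
    | const j =>
      obtain ⟨x, rfl⟩ := (S.constEquiv t.ty j _).surjective y
      -- Every instance is substituted from the generic element `𝟙 (K j)`, at which `codedUnivOf`
      -- takes its constant.
      have h := intro_subst (.const j) x (S.constEquiv t.ty j (terminal.from (K j)) (𝟙 (K j)))
      have e : x ≫ terminal.from (K j) = terminal.from Δ := Subsingleton.elim _ _
      have e' : (S.code (.const j)).subst t.ty x
          (S.constEquiv t.ty j (terminal.from (K j)) (𝟙 (K j))) =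
          S.constEquiv t.ty j (x ≫ terminal.from (K j)) x := by
        rw [← Equiv.symm_apply_eq]
        change (x ≫ 𝟙 (K j) ≫ (S.i j).inv) ≫ (S.i j).hom = x
        simp
      rw [e', e] at h
      refine (congrArg (· ≫ f.ty) h.symm).trans ((Category.assoc _ _ _).trans ?_)
      refine (congrArg _ (H.const j)).trans ?_
      change x ≫ C.const j = ((x ≫ (S.i j).inv) ≫ (S.i j).hom) ≫ C.const j
      simp
  · intro H
    refine ⟨⟨fun x => ?_, fun x => ?_, fun x => ?_, ?_, ?_⟩, fun j => ?_⟩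
    · exact (H .pi _).trans (congrArg C.codes.pi (S.famEquiv_symm_map t _ _ x k f w hf))
    · exact (H .sigma _).trans (congrArg C.codes.sigma (S.famEquiv_symm_map t _ _ x k f w hf))
    · exact (H .eq _).trans (congrArg C.codes.eq (S.pairEquiv_symm_map t _ _ x k f w hf))
    · exact (H .unit _).trans (Category.id_comp _)
    · exact (H .bool _).trans (Category.id_comp _)
    · refine (H (.const j) _).trans ?_
      change ((𝟙 (K j) ≫ (S.i j).inv) ≫ (S.i j).hom) ≫ C.const j = C.const j
      simp

end IRSetup

/-- Universes over `B` are constructed by induction-recursion. -/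
theorem CodedUniv.exists_isInitialOver [LCCC E] {J : Type} [Finite J] {K : J → E} (B : CodedUniv K)
    {U' : Univ E} (hU' : U'.SupportsIR B.U.Ty) (h : Univ.Hom B.U U')
    (hunit : U'.Small (𝟙 (⊤_ E))) (hK : ∀ j, U'.Small (terminal.from (K j))) :
    ∃ (A : CodedUniv K) (t : Univ.Hom A.U B.U), IsInitialOver A B t ∧
      U'.Small (terminal.from A.U.Ty) := by
  obtain ⟨e, he⟩ := hunit
  obtain ⟨F⟩ := Univ.nonempty_funCtx U' B.U.Ty h.ty
  choose a ha using hK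
  choose i _ using fun j => (ha j).exists_iso (Univ.decodes_proj (a j))
  let S : IRSetup B U' := ⟨h, e, he, F, a, i⟩
  obtain ⟨A, hA, hsmall⟩ := hU'.exists_isInitial S.code
  -- The decoded types over `X` are those of the base, pulled back along `T`; thus the pair `(X, T)`
  -- alone is a universe over `B`.
  let t := B.U.restrictHom A.T
  have ht : CodedUniv.IsHom (S.codedUnivOf t A.intro A.intro_subst) B t :=
    S.codedUnivOf_isHom t A.intro A.intro_subst A.intro_T
  refine ⟨S.codedUnivOf t A.intro A.intro_subst, t, ⟨ht, ?_, ?_⟩, hsmall⟩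
  · intro C k hk
    obtain ⟨f, ⟨hf, H⟩, -⟩ := hA (S.algOf C k hk)
    exact ⟨t.ofTy k f hf, (S.isHom_codedUnivOf_iff t A.intro A.intro_subst C k (t.ofTy k f hf)
      (Univ.Hom.ofTy_comp _ _ _ _) hf).2 H, Univ.Hom.ofTy_comp _ _ _ _⟩
  · intro C k hk f g hf hg ef eg
    have ef' : f.ty ≫ k.ty = t.ty := congrArg Univ.Hom.ty ef
    have eg' : g.ty ≫ k.ty = t.ty := congrArg Univ.Hom.ty eg
    have := (hA (S.algOf C k hk)).unique
      ⟨ef', (S.isHom_codedUnivOf_iff t A.intro A.intro_subst C k f ef ef').1 hf⟩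
      ⟨eg', (S.isHom_codedUnivOf_iff t A.intro A.intro_subst C k g eg eg').1 hg⟩
    exact Univ.Hom.ext_of_comp k (ef.trans eg.symm) this

end InitialUniverses

end TarskiUniverse

namespace TarskiUniverse

/-! ### The strict universes over the top universe and their smallness -/

section Construction

variable {E : Type u} [Category.{v} E] [HasFiniteLimits E]

/-- A sequence defined by recursion on all earlier values. -/
def courseOfValues {α : Type*} (F : ∀ i : ℕ, (Fin i → α) → α) (i : ℕ) : α :=
  F i fun k => courseOfValues F k
termination_by i
decreasing_by exact k.2

variable [HasFiniteCoproducts E] [LCCC E]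

namespace WeakHierarchy

variable (W : WeakHierarchy E)

/-- The arguments of the constants of the `i`-th strict universe: the inclusions of the first
`i + 1` weak universes, and the codes of the first `i` strict universes. -/
noncomputable def constArity (i : ℕ) : Fin (i + 1) ⊕ Fin i → E
  | .inl m => (W.U ((m : ℕ) : WithTop ℕ)).Ty
  | .inr _ => ⊤_ E

/-- The top universe with the values of the constants. -/
noncomputable def topUniv (i : ℕ) (s : Fin i → (⊤_ E ⟶ (W.U ⊤).Ty)) :
    CodedUniv (W.constArity i) where
  U := W.U ⊤
  codes := W.codes ⊤
  const
    | .inl m => (W.lift (WithTop.coe_lt_top (m : ℕ))).ty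
    | .inr m => s m

variable {W}

/-- Restriction to the constants of an earlier stage. -/
noncomputable def restrictConst {i j : ℕ} (h : i ≤ j) (A : CodedUniv (W.constArity j)) :
    CodedUniv (W.constArity i) where
  U := A.U
  codes := A.codes
  const
    | .inl m => A.const (.inl (m.castLE (Nat.succ_le_succ h)))
    | .inr m => A.const (.inr (m.castLE h))

theorem restrictConst_isHom {i j : ℕ} (h : i ≤ j) {A B : CodedUniv (W.constArity j)}
    {f : Univ.Hom A.U B.U} (hf : CodedUniv.IsHom A B f) :
    CodedUniv.IsHom (restrictConst h A) (restrictConst h B) f where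
  strict := hf.strict
  const
    | .inl _ => hf.const _
    | .inr _ => hf.const _

theorem isHom_id_restrictConst {i : ℕ} (A : CodedUniv (W.constArity i)) :
    CodedUniv.IsHom A (restrictConst le_rfl A) (Univ.Hom.id A.U) where
  strict := (CodedUniv.IsHom.id A).strict
  const
    | .inl _ => Category.comp_id _
    | .inr _ => Category.comp_id _

variable (W)

/-- A weak universe with chosen values of the constants. -/
noncomputable def baseUniv (i : ℕ) (c : ∀ x, W.constArity i x ⟶ (W.U (i : WithTop ℕ)).Ty) :
    CodedUniv (W.constArity i) where
  U := W.U (i : WithTop ℕ)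
  codes := W.codes _
  const := c

/-- The universes defined by induction-recursion in the top universe. -/
theorem exists_topUniv_initial (hIR : (W.U ⊤).SupportsLargeIR) (i : ℕ)
    (s : Fin i → (⊤_ E ⟶ (W.U ⊤).Ty)) :
    ∃ (A : CodedUniv (W.constArity i)) (t : Univ.Hom A.U (W.topUniv i s).U)
      (c : ⊤_ E ⟶ (W.U ⊤).Ty), CodedUniv.IsInitialOver A (W.topUniv i s) t ∧
        (W.U ⊤).Decodes c (terminal.from A.U.Ty) := by
  have hunit : (W.U ⊤).Small (𝟙 (⊤_ E)) := ⟨_, (W.isWeak ⊤).unit⟩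
  obtain ⟨A, t, hA, c, hc⟩ := (W.topUniv i s).exists_isInitialOver
    (hIR _) (Univ.Hom.id (W.U ⊤)) hunit (by
      rintro (m | m)
      · exact W.small (WithTop.coe_lt_top (m : ℕ))
      · rw [show terminal.from (W.constArity i (.inr m)) = 𝟙 (⊤_ E) from Subsingleton.elim _ _]
        exact hunit)
  exact ⟨A, t, c, hA, hc⟩

/-- The types of `U m` have codes in `U i` by the given lift if `m < i`, and trivially if `m = i`.
Agreement with the lift to `U ⊤` holds up to isomorphism of decoded types, which is all that
`exists_span` requires. -/
theorem exists_base_const {i : ℕ} {s : Fin i → (⊤_ E ⟶ (W.U ⊤).Ty)} {Y : Fin i → E}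
    (hs : ∀ k, (W.U ⊤).Decodes (s k) (terminal.from (Y k)))
    (hY : ∀ k, (W.U (i : WithTop ℕ)).Small (terminal.from (Y k))) :
    ∃ c : ∀ x, W.constArity i x ⟶ (W.U (i : WithTop ℕ)).Ty,
      ∀ x, (W.U (i : WithTop ℕ)).Decodes (c x) ((W.U ⊤).proj ((W.topUniv i s).const x)) := by
  have key : ∀ x, (W.U (i : WithTop ℕ)).Small ((W.U ⊤).proj ((W.topUniv i s).const x)) := by
    rintro (m | m)
    · have hm : (W.U ⊤).Decodes (W.lift (WithTop.coe_lt_top (m : ℕ))).ty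
          (W.U ((m : ℕ) : WithTop ℕ)).p := ⟨_, (W.lift _).isPullback⟩
      rcases (Nat.lt_succ_iff.1 m.2).lt_or_eq with h | h
      · have hlt : ((m : ℕ) : WithTop ℕ) < (i : WithTop ℕ) := by exact_mod_cast h
        exact ⟨_, hm.proj ⟨_, (W.lift hlt).isPullback⟩⟩
      · have : (W.U (i : WithTop ℕ)).Small (W.U ((m : ℕ) : WithTop ℕ)).p := by
          rw [h]
          exact ⟨_, _, (Univ.Hom.id _).isPullback⟩
        obtain ⟨b, hb⟩ := this
        exact ⟨b, hm.proj hb⟩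
    · obtain ⟨b, hb⟩ := hY m
      exact ⟨b, (hs m).proj hb⟩
  choose c hc using key
  exact ⟨c, hc⟩

/-- If the constants have codes in a weak universe, the strict universe maps to it. -/
theorem nonempty_hom_base {i : ℕ} {s : Fin i → (⊤_ E ⟶ (W.U ⊤).Ty)} {Y : Fin i → E}
    (hs : ∀ k, (W.U ⊤).Decodes (s k) (terminal.from (Y k)))
    (hY : ∀ k, (W.U (i : WithTop ℕ)).Small (terminal.from (Y k)))
    {A : CodedUniv (W.constArity i)} {t : Univ.Hom A.U (W.topUniv i s).U}
    (hA : CodedUniv.IsInitialOver A (W.topUniv i s) t) :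
    Nonempty (Univ.Hom A.U (W.U (i : WithTop ℕ))) := by
  obtain ⟨c, hc⟩ := W.exists_base_const hs hY
  obtain ⟨B, f, g, hf, -⟩ := CodedUniv.exists_span (W.topUniv i s) (W.baseUniv i c) (W.isWeak ⊤)
    (W.isWeak _) hc
  obtain ⟨r, -, -⟩ := hA.exists_hom B f hf
  -- This map need not commute with the lift to `U ⊤`, since the decoded types correspond only up to
  -- isomorphism.
  exact ⟨r.comp g⟩

/-- Small induction-recursion constructs the strict universe already in the next weak universe. -/
theorem small_of_supportsSmallIR (hW : W.SupportsSmallIR) {i : ℕ}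
    {s : Fin i → (⊤_ E ⟶ (W.U ⊤).Ty)} {Y : Fin i → E}
    (hs : ∀ k, (W.U ⊤).Decodes (s k) (terminal.from (Y k)))
    (hY : ∀ k, (W.U (i : WithTop ℕ)).Small (terminal.from (Y k)))
    {A : CodedUniv (W.constArity i)} {t : Univ.Hom A.U (W.topUniv i s).U}
    (hA : CodedUniv.IsInitialOver A (W.topUniv i s) t) :
    (W.U ((i + 1 : ℕ) : WithTop ℕ)).Small (terminal.from A.U.Ty) := by
  obtain ⟨c, hc⟩ := W.exists_base_const hs hY
  obtain ⟨B, f, g, hf, hg⟩ := CodedUniv.exists_span (W.topUniv i s) (W.baseUniv i c) (W.isWeak ⊤)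
    (W.isWeak _) hc
  have hlt : ∀ m : ℕ, m < i + 1 → (m : WithTop ℕ) < ((i + 1 : ℕ) : WithTop ℕ) :=
    fun m h => by exact_mod_cast h
  have hunit : (W.U ((i + 1 : ℕ) : WithTop ℕ)).Small (𝟙 (⊤_ E)) := ⟨_, (W.isWeak _).unit⟩
  -- The recursion now takes values in `Ty` of `U i` instead of `U ⊤`, so small induction-recursion
  -- in `U (i + 1)` suffices.
  obtain ⟨A', t', hA', hsmall⟩ := (W.baseUniv i c).exists_isInitialOver (hW i)
    (W.lift (hlt i (Nat.lt_succ_self i))) hunit (by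
      rintro (m | m)
      · exact W.small (hlt m m.2)
      · rw [show terminal.from (W.constArity i (.inr m)) = 𝟙 (⊤_ E) from Subsingleton.elim _ _]
        exact hunit)
  obtain ⟨r, hr, -⟩ := hA'.exists_hom B g hg
  -- Through the span, `A'` also maps strictly to the top universe, and it remains initial there;
  -- hence `A` and `A'` have isomorphic objects of codes.
  obtain ⟨e⟩ := hA.nonempty_iso (hA'.change_base (hr.comp hf))
  obtain ⟨b, hb⟩ := hsmall
  exact ⟨b, hb.of_iso e (Subsingleton.elim _ _)⟩

end WeakHierarchy

end Construction

end TarskiUniverse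

/-! ### The strictly cumulative hierarchy -/

open TarskiUniverse

theorem mainTheorem4 {E : Type u} [Category.{v} E] [HasFiniteLimits E] [HasFiniteCoproducts E]
    [TarskiUniverse.LCCC E] (W : TarskiUniverse.WeakHierarchy E)
    (hIR : (W.U ⊤).SupportsLargeIR) :
    ∃ H : TarskiUniverse.StrictHierarchy W,
      (∀ i : ℕ, (∀ k < i, (W.U (i : WithTop ℕ)).Small (terminal.from (H.V k).Ty)) →
        (H.V i).SameClass (W.U (i : WithTop ℕ))) ∧
      (W.SupportsSmallIR → ∀ i : ℕ, (H.V i).SameClass (W.U (i : WithTop ℕ))) := by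
  choose A' t' c hA' hc' using W.exists_topUniv_initial hIR
  -- The universe at stage `i` depends on the earlier ones only through their codes in `U ⊤`, so the
  -- recursion runs over these codes alone.
  obtain ⟨self, hself⟩ : ∃ self : ℕ → (⊤_ E ⟶ (W.U ⊤).Ty),
      ∀ i, self i = c i fun k => self k :=
    ⟨courseOfValues c, fun i => by rw [courseOfValues]⟩
  let A := fun i => A' i fun k => self k
  let T := fun i => W.topUniv i fun k => self k
  let t : ∀ i, Univ.Hom (A i).U (W.U ⊤) := fun i => t' i fun k => self k
  have hA : ∀ i, CodedUniv.IsInitialOver (A i) (T i) (t i) := fun i => hA' i _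
  have hc : ∀ i, (W.U ⊤).Decodes (self i) (terminal.from (A i).U.Ty) := fun i => by
    rw [hself i]
    exact hc' i _
  have hres : ∀ {i j : ℕ} (h : i ≤ j), CodedUniv.IsHom
      (WeakHierarchy.restrictConst h (A j)) (T i) (t j) := fun {i j} h =>
    { strict := (hA j).isHom.strict
      const := fun x => match x with
        | .inl m => (hA j).isHom.const (.inl (m.castLE (Nat.succ_le_succ h)))
        | .inr m => (hA j).isHom.const (.inr (m.castLE h)) }
  -- The names `uni` are constants, so these lifts preserve them along with the other codes.
  choose L hL hLt using fun (i j : ℕ) (h : i ≤ j) =>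
    (hA i).exists_hom (WeakHierarchy.restrictConst h (A j)) (t j) (hres h)
  let H : StrictHierarchy W :=
    { V := fun i => (A i).U
      dec := t
      codes := fun i => (A i).codes
      injective := fun i => (hA i).isInjective
      dec_strict := fun i => (hA i).isHom.strict
      self := self
      self_decodes := hc
      uni := fun {k i} h => (A i).const (.inr ⟨k, h⟩)
      dec_uni := fun {k i} h => (hA i).isHom.const (.inr ⟨k, h⟩)
      lift := fun {i j} h => L i j h
      lift_refl := fun i => (hA i).hom_ext (WeakHierarchy.restrictConst (le_refl i) (A i))
        (t i) (hres le_rfl) _ _ (hL i i le_rfl)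
        (WeakHierarchy.isHom_id_restrictConst (A i)) (hLt i i le_rfl) (Univ.Hom.id_comp _)
      lift_trans := fun {i j k} h h' => (hA i).hom_ext
        (WeakHierarchy.restrictConst (h.trans h') (A k)) (t k) (hres (h.trans h')) _ _
        ((hL i j h).comp (WeakHierarchy.restrictConst_isHom h (hL j k h')))
        (hL i k (h.trans h')) ((Univ.Hom.comp_assoc (L i j h) (L j k h') (t k)).trans
          ((congrArg (Univ.Hom.comp (L i j h)) (hLt j k h')).trans (hLt i j h))) (hLt i k (h.trans h'))
      lift_dec := fun {i j} h => hLt i j h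
      lift_strict := fun {i j} h => (hL i j h).strict
      lift_uni := fun {k i j} h h' => (hL i j h').const (.inr ⟨k, h⟩)
      -- Stage `i` has constants for `U 0, …, U i`; the last of them names the types of `U i`.
      up := fun i => (W.lift (WithTop.coe_lt_top i)).ofTy (t i) ((A i).const (.inl (Fin.last i)))
        ((hA i).isHom.const (.inl (Fin.last i)))
      up_dec := fun i => Univ.Hom.ofTy_comp _ _ _ _ }
  have same : ∀ i : ℕ, (∀ k < i, (W.U (i : WithTop ℕ)).Small (terminal.from (H.V k).Ty)) →
      (H.V i).SameClass (W.U (i : WithTop ℕ)) := by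
    intro i hi X Γ f
    obtain ⟨r⟩ := W.nonempty_hom_base (fun k : Fin i => hc k) (fun k => hi k k.2) (hA i)
    exact ⟨fun hf => r.small hf, fun hf => (H.up i).small hf⟩
  refine ⟨H, same, fun hW => ?_⟩
  have small : ∀ k i : ℕ, k < i → (W.U (i : WithTop ℕ)).Small (terminal.from (H.V k).Ty) := by
    intro k
    induction k using Nat.strong_induction_on with
    | _ k ih =>
      intro i hki
      have hk : (W.U ((k + 1 : ℕ) : WithTop ℕ)).Small (terminal.from (H.V k).Ty) :=
        -- The induction hypothesis is used at `U k`, where the earlier `V m` have to be small for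
        -- `V k` to be small in `U (k + 1)`; the weak lifts carry this to every later `U i`.
        W.small_of_supportsSmallIR hW (fun m : Fin k => hc m) (fun m => ih m m.2 k m.2) (hA k)
      rcases (Nat.succ_le_of_lt hki).lt_or_eq with h | h
      · have hlt : ((k + 1 : ℕ) : WithTop ℕ) < (i : WithTop ℕ) := by exact_mod_cast h
        exact (W.lift hlt).small hk
      · rw [← h]
        exact hk
  exact fun i => same i fun k hk => small k i hk
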